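/- **Notation.** Write $e(x)=\exp(2\pi i x)$. Let $((x))=x-\lfloor x\rfloor-\tfrac12$ for $x\in\mathbb R\setminus\mathbb Z$ and $((x))=0$ for $x\in\mathbb Z$. For integers $c\ge 1$ and $d$ coprime to $c$, let $s(d,c)=\sum_{r \bmod c}\left(\left(\frac rc\right)\right)\left(\left(\frac{dr}c\right)\right)$ be the Dedekind sum. Let $n$ be an integer. For $p\in\{5,7\}$, $1\le \ell\le p-1$ and $c\ge 1$ with $p\mid c$, put $$S_{\infty\infty}^{(\ell)}(0,n,c,\mu_p)=e(-\tfrac18)\sum_{\substack{d \bmod c,\ \gcd(d,c)=1\\ ad\equiv 1 \,(\mathrm{mod}\, c)}}\frac{(-1)^{\ell c}\,e\!\left(-\frac{3ca\ell^2}{2p^2}\right)}{\sin\left(\frac{\pi a\ell}{p}\right)}\,e^{-\pi i s(d,c)}\,e\!\left(\frac{nd}{c}\right),$$ where $a$ is any inverse of $d$ modulo $c$ (the summand does not depend on this choice). For $1\le\ell\le 6$ and $A\ge1$, let $[A\ell]\in\{0,\dots,6\}$ be the residue of $A\ell$ modulo $7$. If $[A\ell]=1$, write $A\ell=7T+1$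 and put $k=\frac32T^2+\frac12T$; if $[A\ell]=6$, write $A\ell=7T-1$ and put $k=\frac32(T-1)^2+\frac52(T-1)+1$. In these two cases $$S_{0\infty}^{(\ell)}(0,n,A,\mu_7;0)=(-1)^{A\ell-[A\ell]}\sum_{\substack{B \bmod A,\ \gcd(B,A)=1}} e\!\left(\frac{kC}{A}\right)e^{-\pi i s(B,A)}\,e\!\left(\frac{nB}{A}\right),$$ where for each $B$, $C$ is the unique integer with $0\le C<7A$, $7\mid C$ and $BC\equiv-1\pmod A$. In all other cases $S_{0\infty}^{(\ell)}(0,n,A,\mu_7;0)=0$. Let $C_p^{a,b}=\cos(\frac{a\pi}p)-\cos(\frac{b\pi}p)$, and for $7\mid c$, $c\ge 1$, let $$S_7^{(\ell)}(n,c)=\sin(\tfrac{\pi\ell}7)\left(e(-\tfrac18)S_{\infty\infty}^{(\ell)}(0,n,c,\mu_7)+\mathbf 1_{[\frac c7\ell]\in\{1,6\}}\cdot2\sqrt7\,S_{0\infty}^{(\ell)}(0,n,\tfrac c7,\mu_7;0)\right).$$ **Theorem.** (i) For all integers $n\ge0$ and $c\ge1$, and all integers $\ell$ with $1\le\ell\le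 4$ in (5-4) and $1\le\ell\le6$ in (7-5,1) and (7-5,2): - (5-4) If $5\mid c$, then $S_{\infty\infty}^{(\ell)}(0,5n+4,c,\mu_5)=0$. - (7-5,1) If $7\mid c$ and $\frac c7\ell\not\equiv\pm1\pmod 7$, then $S_{\infty\infty}^{(\ell)}(0,7n+5,c,\mu_7)=0$. - (7-5,2) If $c=7a$ with $7\nmid a$ and $a\ell\equiv\pm1\pmod7$, then $e(-\frac18)S_{\infty\infty}^{(\ell)}(0,7n+5,c,\mu_7)+2\sqrt7\,S_{0\infty}^{(\ell)}(0,7n+5,a,\mu_7;0)=0$. (ii) For all integers $n\ge0$ and $c\ge1$ with $5\mid c$ in (5-1), (5-2) and $7\mid c$ in the others: - (5-1) $C_5^{2,4}\sin(\frac\pi5)S_{\infty\infty}^{(1)}(0,5n+1,c,\mu_5)+C_5^{4,2}\sin(\frac{2\pi}5)S_{\infty\infty}^{(2)}(0,5n+1,c,\mu_5)=0$. - (5-2) $C_5^{0,4}\sin(\frac\pi5)S_{\infty\infty}^{(1)}(0,5n+2,c,\mu_5)+C_5^{0,2}\sin(\frac{2\pi}5)S_{\infty\infty}^{(2)}(0,5n+2,c,\mu_5)=0$.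 - (7-0) $C_7^{4,6}S_7^{(1)}(7n,c)+C_7^{6,2}S_7^{(2)}(7n,c)+C_7^{2,4}S_7^{(3)}(7n,c)=0$. - (7-1,1) $C_7^{2,4}S_7^{(1)}(7n+1,c)+C_7^{4,6}S_7^{(2)}(7n+1,c)+C_7^{6,2}S_7^{(3)}(7n+1,c)=0$. - (7-1,2) $C_7^{4,6}S_7^{(1)}(7n+1,c)+C_7^{6,2}S_7^{(2)}(7n+1,c)+C_7^{2,4}S_7^{(3)}(7n+1,c)=0$. - (7-2) $C_7^{0,6}S_7^{(1)}(7n+2,c)+C_7^{0,2}S_7^{(2)}(7n+2,c)+C_7^{0,4}S_7^{(3)}(7n+2,c)=0$. - (7-3,1) $C_7^{0,4}S_7^{(1)}(7n+3,c)+C_7^{0,6}S_7^{(2)}(7n+3,c)+C_7^{0,2}S_7^{(3)}(7n+3,c)=0$. - (7-3,2) $C_7^{2,6}S_7^{(1)}(7n+3,c)+C_7^{4,2}S_7^{(2)}(7n+3,c)+C_7^{6,4}S_7^{(3)}(7n+3,c)=0$. - (7-4,1) $C_7^{0,2}S_7^{(1)}(7n+4,c)+C_7^{0,4}S_7^{(2)}(7n+4,c)+C_7^{0,6}S_7^{(3)}(7n+4,c)=0$.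 - (7-4,2) $C_7^{2,6}S_7^{(1)}(7n+4,c)+C_7^{4,2}S_7^{(2)}(7n+4,c)+C_7^{6,4}S_7^{(3)}(7n+4,c)=0$. - (7-6) $(C_7^{0,4}+C_7^{2,6})S_7^{(1)}(7n+6,c)+(C_7^{0,6}+C_7^{4,2})S_7^{(2)}(7n+6,c)+(C_7^{0,2}+C_7^{6,4})S_7^{(3)}(7n+6,c)=0$. -/

import Mathlib

namespace RankKloosterman

/-- `e(x) = exp(2πix)`. -/
noncomputable def e (x : ℝ) : ℂ := Complex.exp (2 * Real.pi * Complex.I * (x : ℂ))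

/-- The sawtooth function `((x))`: `0` at integers and `x - ⌊x⌋ - 1/2` elsewhere. -/
noncomputable def saw (x : ℝ) : ℝ :=
  if x = (⌊x⌋ : ℝ) then 0 else x - (⌊x⌋ : ℝ) - 1 / 2

/-- The Dedekind sum `s(d,c) = ∑_{r mod c} ((r/c)) ((dr/c))`. -/
noncomputable def dedekindSum (d : ℤ) (c : ℕ) : ℝ :=
  ∑ r ∈ Finset.range c, saw ((r : ℝ) / (c : ℝ)) * saw ((d : ℝ) * (r : ℝ) / (c : ℝ))

/-- The Kloosterman sum `S_{∞∞}^{(ℓ)}(0,n,c,μ_p)`, where `p ∣ c`. For every reduced residue class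
`d` mod `c` the inner sum has exactly one term, the inverse `a` of `d` modulo `c`. -/
noncomputable def SInfInf (p ℓ : ℕ) (n : ℤ) (c : ℕ) : ℂ :=
  e (-(1 / 8)) *
    ∑ d ∈ (Finset.range c).filter (fun d => Nat.Coprime d c),
      ∑ a ∈ (Finset.range c).filter (fun a => a * d ≡ 1 [MOD c]),
        (-1 : ℂ) ^ (ℓ * c) * e (-(3 * (c : ℝ) * (a : ℝ) * (ℓ : ℝ) ^ 2 / (2 * (p : ℝ) ^ 2)))
            / (Real.sin (Real.pi * (a : ℝ) * (ℓ : ℝ) / (p : ℝ)) : ℂ)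
          * Complex.exp (-(Real.pi * Complex.I * (dedekindSum (d : ℤ) c : ℂ)))
          * e ((n : ℝ) * (d : ℝ) / (c : ℝ))

/-- The sum over `B` common to both cases of `S_{0∞}^{(ℓ)}(0,n,A,μ_7;0)`: the sum over reduced
residue classes `B` mod `A` of `e(kC/A) e^{-πi s(B,A)} e(nB/A)`, where `C` is the residue class
modulo `7A` with `7 ∣ C` and `BC ≡ -1 (mod A)`. If `7 ∤ A`, there is exactly one such `C` for each
`B`; it is represented in `0 ≤ C < 7A` (and `C = 0` occurs only for `A = 1`). -/
noncomputable def SZeroInfSum (k : ℝ) (n : ℤ) (A : ℕ) : ℂ :=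
  ∑ B ∈ (Finset.range A).filter (fun B => Nat.Coprime B A),
    ∑ C ∈ (Finset.range (7 * A)).filter
        (fun C : ℕ => 7 ∣ C ∧ (B : ℤ) * (C : ℤ) ≡ -1 [ZMOD (A : ℤ)]),
      e (k * (C : ℝ) / (A : ℝ))
        * Complex.exp (-(Real.pi * Complex.I * (dedekindSum (B : ℤ) A : ℂ)))
        * e ((n : ℝ) * (B : ℝ) / (A : ℝ))

/-- The Kloosterman sum `S_{0∞}^{(ℓ)}(0,n,A,μ_7;0)`; here `[Aℓ] = A * ℓ % 7`. In the first case
`Aℓ = 7T + 1` with `T = Aℓ / 7`, in the second `Aℓ = 7T - 1` with `T = (Aℓ + 1) / 7`; both divisions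
in `ℕ`. -/
noncomputable def SZeroInf (ℓ : ℕ) (n : ℤ) (A : ℕ) : ℂ :=
  if A * ℓ % 7 = 1 then
    (-1 : ℂ) ^ (A * ℓ - A * ℓ % 7) *
      (let T : ℝ := ((A * ℓ / 7 : ℕ) : ℝ)
       SZeroInfSum (3 / 2 * T ^ 2 + 1 / 2 * T) n A)
  else if A * ℓ % 7 = 6 then
    (-1 : ℂ) ^ (A * ℓ - A * ℓ % 7) *
      (let T : ℝ := (((A * ℓ + 1) / 7 : ℕ) : ℝ)
       SZeroInfSum (3 / 2 * (T - 1) ^ 2 + 5 / 2 * (T - 1) + 1) n A)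
  else 0

/-- `C_p^{a,b} = cos(aπ/p) - cos(bπ/p)`. -/
noncomputable def cosDiff (p a b : ℕ) : ℂ :=
  ((Real.cos ((a : ℝ) * Real.pi / (p : ℝ)) - Real.cos ((b : ℝ) * Real.pi / (p : ℝ)) : ℝ) : ℂ)

/-- `sin(πℓ/p)`. -/
noncomputable def sinPi (p ℓ : ℕ) : ℂ :=
  ((Real.sin (Real.pi * (ℓ : ℝ) / (p : ℝ)) : ℝ) : ℂ)

/-- The combined sum `S_7^{(ℓ)}(n,c)`, where `7 ∣ c`. -/
noncomputable def S7 (ℓ : ℕ) (n : ℤ) (c : ℕ) : ℂ :=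
  sinPi 7 ℓ *
    (e (-(1 / 8)) * SInfInf 7 ℓ n c +
      if c / 7 * ℓ % 7 = 1 ∨ c / 7 * ℓ % 7 = 6 then
        2 * (Real.sqrt 7 : ℂ) * SZeroInf ℓ n (c / 7)
      else 0)

end RankKloosterman

open RankKloosterman

namespace RankKloosterman

open Finset NumberTheorySymbols

/-! Write c = pA and ζ = e(1/p). The engine is the closed form of the eta multiplier,
`dedekindRoot_eq`: for d coprime to 24c and a inverse to d modulo 24c, e^{-πi s(d,c)} = -(c/d)
e(-(d+a)/(24c)) e(-a(c+9)/24). It follows from Dedekind reciprocity together with the values of 12 d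
s(c,d) modulo 3 and modulo 8. The residues d mod c are then grouped by their class mod A; inside a
class d moves in steps of 24A, which fixes d modulo 24 and keeps the Jacobi symbol under control.

If p ∤ A, each summand is a constant of the class, independent of ℓ, times a factor depending only
on ℓ, the position t in the class, and n and A modulo p (`infTerm_progression`). Multiplying by
sin(πℓ/p) clears the sine in the denominator, so sin(πℓ/p) times the Kloosterman sum is a constant
common to all ℓ times an explicit Laurent polynomial at ζ. For p = 7 and Aℓ ≡ ±1 the sum at the cusp
0 is built from the same class constants, and √7 enters as the quadratic Gauss sum (`zeroTerm_eq`,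
`evalZt_gaussTerms`), so `S7` has the same shape.

If p ∣ A, the sine kernel is constant on a class and the remaining sum is geometric in ζ^(24n-1+a²);
a class survives only if a² ≡ 1 - 24n mod p (`exists_weights_of_dvd`).

Either way each relation reduces to finitely many assertions that a Laurent polynomial vanishes at
ζ. This holds when all its coefficients modulo X^p - 1 agree (`evalZt_eq_zero`), a condition that
`identityCheck` decides. -/

/-! ### Dedekind sums and their reciprocity law -/

theorem saw_eq_fract (x : ℝ) : saw x = if Int.fract x = 0 then 0 else Int.fract x - 1 / 2 := by
  have : (x = (⌊x⌋ : ℝ)) ↔ Int.fract x = 0 := by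
    rw [Int.fract, sub_eq_zero]
  by_cases h : Int.fract x = 0
  · rw [saw, if_pos (this.2 h), if_pos h]
  · rw [saw, if_neg (mt this.1 h), if_neg h, Int.fract]

theorem saw_add_int (x : ℝ) (m : ℤ) : saw (x + m) = saw x := by
  simp [saw_eq_fract]

theorem saw_neg (x : ℝ) : saw (-x) = -saw x := by
  rw [saw_eq_fract, saw_eq_fract]
  by_cases h : Int.fract x = 0
  · simp [h]
  · rw [Int.fract_neg h, if_neg, if_neg h]
    · ring
    · have := Int.fract_lt_one x
      linarith

theorem dedekindSum_neg (d : ℤ) (c : ℕ) : dedekindSum (-d) c = -dedekindSum d c := by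
  unfold dedekindSum
  rw [← sum_neg_distrib]
  refine sum_congr rfl fun r _ => ?_
  have : ((-d : ℤ) : ℝ) * r / c = -((d : ℝ) * r / c) := by push_cast; ring
  rw [this, saw_neg]; ring

theorem dedekindSum_congr {d d' : ℤ} {c : ℕ} (h : d ≡ d' [ZMOD c]) :
    dedekindSum d c = dedekindSum d' c := by
  rcases Nat.eq_zero_or_pos c with rfl | hc
  · simp [dedekindSum]
  obtain ⟨k, hk⟩ := h.dvd
  unfold dedekindSum
  refine sum_congr rfl fun r _ => ?_
  have hc' : (c : ℝ) ≠ 0 := by positivity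
  have : (d' : ℝ) * r / c = (d : ℝ) * r / c + ((k * r : ℤ) : ℝ) := by
    have : d' = d + c * k := by linarith
    rw [this]; push_cast; field_simp
  rw [this, saw_add_int]

/-- The weighted floor sum `∑ r ⌊hr/k⌋` over `0 < r < k`. -/
def floorSum (h k : ℕ) : ℕ := ∑ r ∈ range k, r * (h * r / k)

theorem sum_range_mod {M : Type*} [AddCommMonoid M] {h k : ℕ} (hk : 0 < k) (hc : h.Coprime k)
    (f : ℕ → M) : ∑ r ∈ range k, f (h * r % k) = ∑ r ∈ range k, f r := by
  have hinj : Set.InjOn (fun r => h * r % k) (range k : Finset ℕ) := by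
    intro r hr s hs hrs
    have h1 : h * r ≡ h * s [MOD k] := hrs
    have h2 := Nat.ModEq.cancel_left_of_coprime (by rwa [Nat.gcd_comm]) h1
    exact Nat.ModEq.eq_of_lt_of_lt h2 (by simpa using hr) (by simpa using hs)
  have himg : (range k).image (fun r => h * r % k) = range k := by
    apply eq_of_subset_of_card_le
    · intro x hx
      simp only [mem_image, mem_range] at hx ⊢
      obtain ⟨r, _, rfl⟩ := hx
      exact Nat.mod_lt _ hk
    · rw [card_image_of_injOn hinj]
  conv_rhs => rw [← himg, sum_image hinj]

theorem sum_range_cast (k : ℕ) : 2 * ∑ r ∈ range k, (r : ℤ) = k * (k - 1) := by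
  induction k with
  | zero => simp
  | succ k ih => rw [sum_range_succ, mul_add, ih]; push_cast; ring

theorem sum_range_sq_cast (k : ℕ) :
    6 * ∑ r ∈ range k, (r : ℤ) ^ 2 = k * (k - 1) * (2 * k - 1) := by
  induction k with
  | zero => simp
  | succ k ih => rw [sum_range_succ, mul_add, ih]; push_cast; ring

theorem sum_floor {h k : ℕ} (hk : 0 < k) (hc : h.Coprime k) :
    2 * ∑ r ∈ range k, ((h * r / k : ℕ) : ℤ) = (h - 1) * (k - 1) := by
  have h1 := sum_range_mod hk hc (fun r => (r : ℤ))
  have h2 : ∀ r : ℕ, ((h * r % k : ℕ) : ℤ) = h * r - k * ((h * r / k : ℕ) : ℤ) := by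
    intro r
    have := Nat.mod_add_div (h * r) k
    zify at this
    push_cast
    linarith
  simp only [h2, sum_sub_distrib, ← mul_sum] at h1
  have h3 := sum_range_cast k
  have hk' : (k : ℤ) ≠ 0 := by positivity
  apply mul_left_cancel₀ hk'
  linear_combination (-2 : ℤ) * h1 + (h - 1) * h3

theorem saw_div {m k : ℕ} (hk : 0 < k) (hm : m % k ≠ 0) :
    saw ((m : ℝ) / k) = ((m % k : ℕ) : ℝ) / k - 1 / 2 := by
  have hf : Int.fract ((m : ℝ) / k) = ((m % k : ℕ) : ℝ) / k := by
    have := Int.fract_div_natCast_eq_div_natCast_mod (k := ℝ) (m := m) (n := k)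
    exact this
  rw [saw_eq_fract, hf, if_neg]
  have hk' : (k : ℝ) ≠ 0 := by positivity
  simp [hk', hm]

theorem twelve_mul_dedekindSum {h k : ℕ} (hk : 0 < k) (hc : h.Coprime k) :
    12 * (k : ℝ) * dedekindSum h k =
      ((2 * h * (k - 1) * (2 * k - 1) - 12 * (floorSum h k : ℤ) - 3 * k * (k - 1) : ℤ) : ℝ) := by
  have hk' : (k : ℝ) ≠ 0 := by positivity
  obtain ⟨j, rfl⟩ : ∃ j, k = j + 1 := ⟨k - 1, by omega⟩
  set k := j + 1 with hkdef
  -- The correction 1/4 is the term r = 0: there the sawtooth is 0, while the formula x - 1/2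
  -- contributes (-1/2)².
  have key : dedekindSum h k = ∑ r ∈ range k, ((r : ℝ) / k - 1 / 2) *
      (((h * r % k : ℕ) : ℝ) / k - 1 / 2) - 1 / 4 := by
    unfold dedekindSum
    rw [hkdef, sum_range_succ', sum_range_succ']
    have : saw (((0 : ℕ) : ℝ) / ((j + 1 : ℕ) : ℝ)) = 0 := by simp [saw]
    rw [this]
    simp only [zero_mul, add_zero, mul_zero, Nat.zero_mod]
    have e1 : (((0 : ℕ) : ℝ) / ((j + 1 : ℕ) : ℝ) - 1 / 2) *
      (((0 : ℕ) : ℝ) / ((j + 1 : ℕ) : ℝ) - 1 / 2) = 1 / 4 := by norm_num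
    rw [e1, add_sub_cancel_right]
    refine sum_congr rfl fun r hr => ?_
    have hr' : r < j := by simpa using hr
    have hm1 : (r + 1) % (j + 1) ≠ 0 := by
      rw [Nat.mod_eq_of_lt (by omega)]; omega
    have hm2 : h * (r + 1) % (j + 1) ≠ 0 := by
      intro h0
      have := (Nat.Coprime.dvd_of_dvd_mul_left hc.symm (Nat.dvd_of_mod_eq_zero h0))
      exact hm1 (Nat.mod_eq_zero_of_dvd this)
    have := saw_div (Nat.succ_pos j) hm1
    rw [Nat.mod_eq_of_lt (by omega : r + 1 < j + 1)] at this
    rw [this, ← saw_div (Nat.succ_pos j) hm2]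
    push_cast
    rfl
  have h2 : ∀ r : ℕ, ((h * r % k : ℕ) : ℝ) = h * r - k * ((h * r / k : ℕ) : ℝ) := by
    intro r
    have := Nat.mod_add_div (h * r) k
    have : (((h * r % k + k * (h * r / k) : ℕ)) : ℝ) = ((h * r : ℕ) : ℝ) := by rw [this]
    push_cast at this
    linarith
  have key2 : (k : ℝ) * dedekindSum h k + k / 4 = h / k * ∑ r ∈ range k, (r : ℝ) ^ 2
      - ∑ r ∈ range k, (r : ℝ) * ((h * r / k : ℕ) : ℝ) - (h + 1) / 2 * ∑ r ∈ range k, (r : ℝ)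
      + k / 2 * ∑ r ∈ range k, ((h * r / k : ℕ) : ℝ) + k * k / 4 := by
    rw [key]
    have e1 : (k : ℝ) * k / 4 = ∑ r ∈ range k, (k : ℝ) / 4 := by simp; ring
    rw [e1]
    simp only [mul_sum, mul_sub, ← sum_sub_distrib, ← sum_add_distrib]
    rw [sub_add_eq_add_sub, add_sub_assoc, show (k : ℝ) / 4 - k * (1 / 4) = 0 by ring, add_zero]
    refine sum_congr rfl fun r _ => ?_
    rw [h2]; field_simp; ring
  have s1 := congrArg (fun z : ℤ => (z : ℝ)) (sum_range_cast k)
  have s2 := congrArg (fun z : ℤ => (z : ℝ)) (sum_range_sq_cast k)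
  have s3 := congrArg (fun z : ℤ => (z : ℝ)) (sum_floor hk hc)
  simp only [Int.cast_mul, Int.cast_sum, Int.cast_natCast, Int.cast_sub, Int.cast_one,
    Int.cast_ofNat, Int.cast_pow] at s1 s2 s3
  have s4 : (floorSum h k : ℝ) = ∑ r ∈ range k, (r : ℝ) * ((h * r / k : ℕ) : ℝ) := by
    simp [floorSum]
  simp only [Int.cast_mul, Int.cast_natCast, Int.cast_sub, Int.cast_one, Int.cast_ofNat]
  rw [s4]
  have s2' : ∑ r ∈ range k, (r : ℝ) ^ 2 = k * (k - 1) * (2 * k - 1) / 6 := by linarith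
  rw [s2'] at key2
  have e2 : (h : ℝ) / k * (k * (k - 1) * (2 * k - 1) / 6) = h * (k - 1) * (2 * k - 1) / 6 := by
    field_simp
  rw [e2] at key2
  linear_combination 12 * key2 - 3 * (h + 1) * s1 + 3 * k * s3

/-- A lattice point count: q(q+1) is the sum of 2v over v ≤ q, and for 0 < v < h the condition v ≤
⌊hr/k⌋ is the same as ⌊kv/h⌋ < r. Exchanging the two summations swaps the roles of h and k. -/
theorem sum_floor_mul {h k : ℕ} (hh : 0 < h) (hk : 0 < k) (hc : h.Coprime k) :
    ∑ r ∈ range k, ((h * r / k : ℕ) : ℤ) * ((h * r / k : ℕ) + 1) =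
      (k - 1) * (h * (h - 1)) - 2 * floorSum k h := by
  have e1 : ∀ r ∈ range k, ((h * r / k : ℕ) : ℤ) * ((h * r / k : ℕ) + 1) =
      ∑ v ∈ range h, if k * v / h < r then 2 * (v : ℤ) else 0 := by
    intro r hr
    have hr' : r < k := by simpa using hr
    have hq : h * r / k < h := by
      rw [Nat.div_lt_iff_lt_mul hk]; nlinarith
    have : (range h).filter (fun v => v ≠ 0 ∧ k * v / h < r) =
        (range (h * r / k + 1)).filter (fun v => v ≠ 0) := by
      ext v
      simp only [mem_filter, mem_range]
      constructor
      · rintro ⟨hv, hv0, hlt⟩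
        refine ⟨?_, hv0⟩
        rw [Nat.div_lt_iff_lt_mul hh] at hlt
        rw [Nat.lt_succ_iff, Nat.le_div_iff_mul_le hk]
        nlinarith
      · rintro ⟨hv, hv0⟩
        rw [Nat.lt_succ_iff, Nat.le_div_iff_mul_le hk] at hv
        have hvh : v < h := by
          by_contra hcon
          push Not at hcon
          have : h * r < h * k := Nat.mul_lt_mul_of_pos_left hr' hh
          nlinarith
        refine ⟨hvh, hv0, ?_⟩
        rw [Nat.div_lt_iff_lt_mul hh]
        -- Points on the diagonal kv = hr are excluded by coprimality, since h would divide v with 0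
        -- < v < h.
        rcases Nat.lt_or_ge (k * v) (r * h) with h1 | h1
        · exact h1
        · have h2 : k * v = h * r := by nlinarith
          have h3 : h ∣ v := hc.dvd_of_dvd_mul_left (h2 ▸ Dvd.intro _ rfl)
          exact absurd (Nat.le_of_dvd (Nat.pos_of_ne_zero hv0) h3) (by omega)
    have e2 : (∑ v ∈ range h, if k * v / h < r then 2 * (v : ℤ) else 0) =
        ∑ v ∈ (range h).filter (fun v => v ≠ 0 ∧ k * v / h < r), 2 * (v : ℤ) := by
      rw [sum_filter]
      refine sum_congr rfl fun v _ => ?_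
      by_cases hv : v = 0
      · simp [hv]
      · simp [hv]
    rw [e2, this, sum_filter]
    have e3 : ∀ v ∈ range (h * r / k + 1), (if v ≠ 0 then 2 * (v : ℤ) else 0) = 2 * (v : ℤ) := by
      intro v _
      by_cases hv : v = 0
      · simp [hv]
      · simp [hv]
    rw [sum_congr rfl e3, ← mul_sum, sum_range_cast]
    push_cast; ring
  rw [sum_congr rfl e1, sum_comm]
  have e4 : ∀ v ∈ range h, (∑ r ∈ range k, if k * v / h < r then 2 * (v : ℤ) else 0) =
      (k - 1) * (2 * v) - 2 * ((v * (k * v / h) : ℕ) : ℤ) := by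
    intro v hv
    have hv' : v < h := by simpa using hv
    have hq : k * v / h < k := by
      rw [Nat.div_lt_iff_lt_mul hh]; nlinarith
    rw [← sum_filter]
    have : (range k).filter (fun r => k * v / h < r) = Ico (k * v / h + 1) k := by
      ext r; simp; omega
    rw [this, sum_const, Nat.card_Ico]
    simp only [nsmul_eq_mul]
    rw [Nat.cast_sub (by omega)]
    push_cast; ring
  rw [sum_congr rfl e4, sum_sub_distrib, ← mul_sum, ← mul_sum, ← mul_sum, sum_range_cast]
  simp [floorSum]

/-- Multiplication by h permutes the residues mod k, so the squares of hr - k⌊hr/k⌋ sum to the same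
value as the r². Expanding gives `floorSum h k` from the cross term and `floorSum k h` from the
squared floors. -/
theorem floorSum_reciprocity {h k : ℕ} (hh : 0 < h) (hk : 0 < k) (hc : h.Coprime k) :
    12 * ((h : ℤ) * floorSum h k + k * floorSum k h) =
      (h ^ 2 - 1) * (k - 1) * (2 * k - 1) + 3 * k * (h - 1) * (k - 1) * (2 * h - 1) := by
  have h1 := sum_range_mod hk hc (fun r => (r : ℤ) ^ 2)
  have h2 : ∀ r : ℕ, ((h * r % k : ℕ) : ℤ) ^ 2 = h ^ 2 * (r : ℤ) ^ 2
      - 2 * h * k * ((r * (h * r / k) : ℕ) : ℤ)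
      + k ^ 2 * (((h * r / k : ℕ) : ℤ) * ((h * r / k : ℕ) + 1) - ((h * r / k : ℕ) : ℤ)) := by
    intro r
    have := Nat.mod_add_div (h * r) k
    zify at this
    have : ((h * r % k : ℕ) : ℤ) = h * r - k * ((h * r / k : ℕ) : ℤ) := by push_cast; linarith
    rw [this]; push_cast; ring
  simp only [h2, sum_sub_distrib, sum_add_distrib, ← mul_sum] at h1
  rw [sum_floor_mul hh hk hc] at h1
  have h3 := sum_floor hk hc
  have h4 := sum_range_sq_cast k
  have h5 : ∑ r ∈ range k, ((r * (h * r / k) : ℕ) : ℤ) = floorSum h k := by simp [floorSum]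
  rw [h5] at h1
  have hk' : (k : ℤ) ≠ 0 := by positivity
  apply mul_left_cancel₀ hk'
  linear_combination (-6) * h1 - 3 * k ^ 2 * h3 + (h ^ 2 - 1) * h4

theorem dedekindSum_reciprocity {h k : ℕ} (hh : 0 < h) (hk : 0 < k) (hc : h.Coprime k) :
    (h : ℝ) * (12 * k * dedekindSum h k) + k * (12 * h * dedekindSum k h) =
      h ^ 2 + k ^ 2 + 1 - 3 * h * k := by
  have e1 := twelve_mul_dedekindSum hk hc
  have e2 := twelve_mul_dedekindSum hh hc.symm
  rw [e1, e2]
  have := floorSum_reciprocity hh hk hc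
  have := congrArg (fun z : ℤ => (z : ℝ)) this
  push_cast at this ⊢
  linear_combination -this

/-! ### Dedekind sums modulo 3 and modulo 8 -/

/-- `12 c s(d,c)` is an integer, divisible by `3` when `3 ∤ c`. -/
theorem exists_int_twelve_mul_dedekindSum {d : ℤ} {c : ℕ} (hc : 0 < c) (hd : IsCoprime d c) :
    ∃ N : ℤ, 12 * (c : ℝ) * dedekindSum d c = N ∧ (¬ 3 ∣ c → (3 : ℤ) ∣ N) := by
  obtain ⟨h, hh⟩ : ∃ h : ℕ, d ≡ h [ZMOD c] := by
    refine ⟨(d % c).toNat, ?_⟩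
    rw [Int.toNat_of_nonneg (Int.emod_nonneg _ (by positivity))]
    exact (Int.mod_modEq _ _).symm
  have hcop : h.Coprime c := by
    rw [← Nat.isCoprime_iff_coprime]
    obtain ⟨k, hk⟩ := hh.dvd
    have : (h : ℤ) = d + c * k := by linarith
    rw [this]
    exact IsCoprime.add_mul_left_left hd k
  rw [dedekindSum_congr hh, twelve_mul_dedekindSum hc hcop]
  refine ⟨_, rfl, fun h3 => ?_⟩
  have e1 : (3 : ℤ) ∣ ((c : ℤ) - 1) * (2 * c - 1) := by
    have : (c : ℤ) % 3 = 1 ∨ (c : ℤ) % 3 = 2 := by omega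
    rcases this with h | h
    · exact Dvd.dvd.mul_right (by omega) _
    · exact Dvd.dvd.mul_left (by omega) _
  obtain ⟨m, hm⟩ := e1
  refine ⟨2 * h * m - 4 * floorSum h c - c * (c - 1), ?_⟩
  linear_combination 2 * (h : ℤ) * hm

/-- The inductive step for the congruence modulo 8, with Y = 12k s(h,k), Y' = 12h s(k,h), J = (h/k),
J' = (k/h): reciprocity of Dedekind sums matches quadratic reciprocity. Since h is odd, the claim
may be multiplied by h, and only residues modulo 8 matter. -/
theorem reciprocity_mod_eight {h k Y Y' J J' : ℤ} (hh : h % 2 = 1) (hk : k % 2 = 1)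
    (hrec : h * Y + k * Y' = h ^ 2 + k ^ 2 + 1 - 3 * h * k) (hY' : (8 : ℤ) ∣ Y' - (h + 1 - 2 * J'))
    (hJ' : J' = 1 ∨ J' = -1) (hJ : J = if h % 4 = 3 ∧ k % 4 = 3 then -J' else J') :
    (8 : ℤ) ∣ Y - (k + 1 - 2 * J) := by
  have hkey : (8 : ℤ) ∣ h * (Y - (k + 1 - 2 * J)) := by
    obtain ⟨m, hm⟩ := hY'
    have e : h * (Y - (k + 1 - 2 * J)) =
      h ^ 2 + k ^ 2 + 1 - 3 * h * k - k * (h + 1 - 2 * J') - h * (k + 1 - 2 * J) - 8 * (k * m) := by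
      linear_combination hrec - k * hm
    rw [e]
    apply dvd_sub _ (Dvd.intro _ rfl)
    obtain ⟨x, hx⟩ : ∃ x, h = 8 * x + h % 8 := ⟨h / 8, by omega⟩
    obtain ⟨y, hy⟩ : ∃ y, k = 8 * y + k % 8 := ⟨k / 8, by omega⟩
    have h8 : h % 8 = 1 ∨ h % 8 = 3 ∨ h % 8 = 5 ∨ h % 8 = 7 := by omega
    have k8 : k % 8 = 1 ∨ k % 8 = 3 ∨ k % 8 = 5 ∨ k % 8 = 7 := by omega
    have h4 : h % 4 = h % 8 % 4 := by omega
    have k4 : k % 4 = k % 8 % 4 := by omega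
    rw [h4, k4] at hJ
    generalize h % 8 = h0 at *
    generalize k % 8 = k0 at *
    subst hx hy
    rw [Int.dvd_iff_emod_eq_zero]
    rcases h8 with rfl | rfl | rfl | rfl <;> rcases k8 with rfl | rfl | rfl | rfl <;>
      rcases hJ' with rfl | rfl <;> norm_num at hJ <;> subst hJ <;> ring_nf <;> omega
  have hcop : IsCoprime (8 : ℤ) h := by
    have : IsCoprime ((2 : ℤ) ^ 3) h := by
      apply IsCoprime.pow_left
      exact ⟨-(h / 2), 1, by omega⟩
    exact this
  exact hcop.dvd_of_dvd_mul_left hkey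

/-- Compatibility with h ↦ -h: the Dedekind sum is odd in h and the Jacobi symbol picks up (-1/k).
-/
theorem neg_mod_eight {k Y J : ℤ} (hk : k % 2 = 1) (hY : (8 : ℤ) ∣ Y - (k + 1 - 2 * J))
    (hJ : J = 1 ∨ J = -1) :
    (8 : ℤ) ∣ -Y - (k + 1 - 2 * (if k % 4 = 1 then J else -J)) := by
  split_ifs <;> rcases hJ with rfl | rfl <;> omega

/-- `12 k s(h,k) ≡ k + 1 - 2 (h/k) (mod 8)` for odd `k`. -/
theorem twelve_mul_dedekindSum_mod_eight (k : ℕ) (hk : k % 2 = 1) (h : ℤ) (hc : IsCoprime h k) :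
    ∃ N : ℤ, 12 * (k : ℝ) * dedekindSum h k = N ∧ (8 : ℤ) ∣ N - (k + 1 - 2 * J(h | k)) := by
  induction k using Nat.strong_induction_on generalizing h with
  | _ k ih =>
  rcases Nat.lt_or_ge 1 k with hk1 | hk1
  swap
  · have : k = 1 := by omega
    subst this
    refine ⟨0, ?_, ?_⟩
    · simp [dedekindSum, saw]
    · simp
  have odd_case : ∀ m : ℕ, m % 2 = 1 → m < k → m.Coprime k →
      ∃ N : ℤ, 12 * (k : ℝ) * dedekindSum m k = N ∧ (8 : ℤ) ∣ N - (k + 1 - 2 * J((m : ℤ) | k)) := by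
    intro m hm hmk hmc
    obtain ⟨N', hN', hN'8⟩ := ih m hmk hm k (Nat.isCoprime_iff_coprime.2 hmc.symm)
    obtain ⟨N, hN, -⟩ := exists_int_twelve_mul_dedekindSum (by omega)
      (Nat.isCoprime_iff_coprime.2 hmc)
    refine ⟨N, hN, ?_⟩
    have hrec := dedekindSum_reciprocity (by omega : 0 < m) (by omega : 0 < k) hmc
    rw [hN, hN'] at hrec
    have hrec' : (m : ℤ) * N + k * N' = m ^ 2 + k ^ 2 + 1 - 3 * m * k := by exact_mod_cast hrec
    refine reciprocity_mod_eight (J' := J((k : ℤ) | m)) (by omega) (by omega) hrec' hN'8 ?_ ?_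
    · exact jacobiSym.eq_one_or_neg_one (by simpa using hmc.symm)
    · have := jacobiSym.quadratic_reciprocity_if hm hk
      rw [← this]
      have e1 : (m % 4 = 3 ∧ k % 4 = 3) ↔ ((m : ℤ) % 4 = 3 ∧ (k : ℤ) % 4 = 3) := by omega
      simp only [e1]
  set m := (h % k).toNat with hmdef
  have hk0 : (k : ℤ) ≠ 0 := by omega
  have hm : (m : ℤ) = h % k := by
    rw [hmdef, Int.toNat_of_nonneg (Int.emod_nonneg _ hk0)]
  have hmk : m < k := by
    have := Int.emod_lt_of_pos h (by omega : (0 : ℤ) < k)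
    omega
  have hcong : h ≡ m [ZMOD k] := by rw [hm]; exact (Int.mod_modEq _ _).symm
  have hmcop : m.Coprime k := by
    rw [← Nat.isCoprime_iff_coprime]
    obtain ⟨j, hj⟩ := hcong.dvd
    have : (m : ℤ) = h + k * j := by linarith
    rw [this]
    exact IsCoprime.add_mul_left_left hc j
  rw [dedekindSum_congr hcong, jacobiSym.mod_left' hcong]
  rcases Nat.mod_two_eq_zero_or_one m with hpar | hpar
  swap
  · exact odd_case m hpar hmk hmcop
  -- Reciprocity needs an odd numerator: for even m, the number k - m is odd and congruent to -m.
  have hcop' : (k - m).Coprime k := by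
    rw [Nat.coprime_self_sub_left hmk.le]; exact hmcop
  have hcop'' : Int.gcd ((k - m : ℕ) : ℤ) k = 1 := by simpa using hcop'
  have hm0 : m ≠ 0 := by
    rintro h0
    rw [h0] at hmcop
    simp at hmcop
    omega
  obtain ⟨N, hN, hN8⟩ := odd_case (k - m) (by omega) (by omega) hcop'
  have hcong' : (m : ℤ) ≡ -((k - m : ℕ) : ℤ) [ZMOD k] := by
    rw [Nat.cast_sub hmk.le]
    exact (Int.modEq_iff_dvd.2 ⟨-1, by ring⟩)
  refine ⟨-N, ?_, ?_⟩
  · rw [dedekindSum_congr hcong', dedekindSum_neg]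
    push_cast at hN ⊢
    linarith
  · rw [jacobiSym.mod_left' hcong', jacobiSym.neg _ (Nat.odd_iff.2 hk)]
    have := neg_mod_eight (by omega) hN8 (jacobiSym.eq_one_or_neg_one hcop'')
    have e1 : ZMod.χ₄ k = if (k : ℤ) % 4 = 1 then 1 else -1 := by
      rw [ZMod.χ₄_nat_eq_if_mod_four, if_neg (by omega)]
      simp only [show (k : ℤ) % 4 = 1 ↔ k % 4 = 1 by omega]
    rw [e1]
    convert this using 4
    split_ifs <;> simp

/-! ### Closed form of the eta multiplier -/

theorem e_add (x y : ℝ) : e (x + y) = e x * e y := by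
  rw [e, e, e, ← Complex.exp_add]; push_cast; ring_nf

theorem e_int (m : ℤ) : e m = 1 := by
  rw [e, Complex.exp_eq_one_iff]
  exact ⟨m, by push_cast; ring⟩

theorem e_eq_of_sub_eq_int {x y : ℝ} (m : ℤ) (h : x - y = m) : e x = e y := by
  have : x = y + m := by linarith
  rw [this, e_add, e_int, mul_one]

theorem e_zero : e 0 = 1 := by simpa using e_int 0

theorem e_neg (x : ℝ) : e (-x) = (e x)⁻¹ := by
  apply eq_inv_of_mul_eq_one_left
  rw [← e_add, neg_add_cancel, e_zero]

theorem e_ne_zero (x : ℝ) : e x ≠ 0 := Complex.exp_ne_zero _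

theorem e_half : e (1 / 2) = -1 := by
  rw [e, ← Complex.exp_pi_mul_I]; congr 1; push_cast; ring

theorem e_half_int (m : ℤ) : e (m / 2) = (-1) ^ m := by
  rcases Int.even_or_odd' m with ⟨k, rfl | rfl⟩
  · rw [Even.neg_one_zpow (by simp), ← e_int k]; congr 1; push_cast; ring
  · rw [Odd.neg_one_zpow (by simp), ← e_half]
    exact e_eq_of_sub_eq_int k (by push_cast; ring)

/-- The root of unity `e^{-πi s(d,c)}`. -/
noncomputable def dedekindRoot (d : ℤ) (c : ℕ) : ℂ :=
  Complex.exp (-(Real.pi * Complex.I * (dedekindSum d c : ℂ)))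

theorem dedekindRoot_eq_e {d : ℤ} {c : ℕ} (hc : 0 < c) {N : ℤ}
    (hN : 12 * (c : ℝ) * dedekindSum d c = N) : dedekindRoot d c = e (-(N / (24 * c))) := by
  rw [dedekindRoot, e, ← hN]
  congr 1
  have : (c : ℂ) ≠ 0 := by exact_mod_cast hc.ne'
  push_cast
  field_simp
  ring

theorem dedekindRoot_congr {d d' : ℤ} {c : ℕ} (h : d ≡ d' [ZMOD c]) :
    dedekindRoot d c = dedekindRoot d' c := by
  rw [dedekindRoot, dedekindSum_congr h, dedekindRoot]

/-- The closed form of `e^{-πi s(d,c)}` in terms of a Jacobi symbol, for `d` coprime to `6c`. -/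
theorem dedekindRoot_eq {c d : ℕ} (hc : 0 < c) (hd : d.Coprime (24 * c)) {a : ℤ}
    (ha : a * d ≡ 1 [ZMOD (24 * c : ℕ)]) :
    dedekindRoot d c =
      -(J((c : ℤ) | d) : ℂ) * e (-((d + a) / (24 * c))) * e (-(a * (c + 9) / 24)) := by
  have hdc : d.Coprime c := Nat.Coprime.coprime_mul_left_right hd
  have hd24 : d.Coprime 24 := Nat.Coprime.coprime_mul_right_right hd
  have hd2 : d % 2 = 1 := by
    have := Nat.Coprime.coprime_dvd_right (by norm_num : 2 ∣ 24) hd24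
    rw [Nat.coprime_two_right] at this
    exact Nat.odd_iff.1 this
  have hd3 : ¬ 3 ∣ d := by
    have := Nat.Coprime.coprime_dvd_right (by norm_num : 3 ∣ 24) hd24
    rw [Nat.coprime_comm, Nat.Prime.coprime_iff_not_dvd Nat.prime_three] at this
    exact this
  obtain ⟨N, hN, -⟩ := exists_int_twelve_mul_dedekindSum hc (Nat.isCoprime_iff_coprime.2 hdc)
  obtain ⟨X, hX, hX8⟩ := twelve_mul_dedekindSum_mod_eight d hd2 c
    (Nat.isCoprime_iff_coprime.2 hdc.symm)
  obtain ⟨X', hX', hX3⟩ := exists_int_twelve_mul_dedekindSum (by omega)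
    (Nat.isCoprime_iff_coprime.2 hdc.symm)
  have : X' = X := by exact_mod_cast hX'.symm.trans hX
  subst this
  have hX3 := hX3 hd3
  have hrec := dedekindSum_reciprocity (by omega : 0 < d) hc hdc
  rw [hN, hX] at hrec
  have hrec' : (d : ℤ) * N + c * X' = d ^ 2 + c ^ 2 + 1 - 3 * d * c := by exact_mod_cast hrec
  have hJ : J((c : ℤ) | d) = 1 ∨ J((c : ℤ) | d) = -1 :=
    jacobiSym.eq_one_or_neg_one (by simpa using hdc.symm)
  obtain ⟨j, hj⟩ := ha.symm.dvd
  push_cast at hj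
  have ha2 : a % 2 = 1 := by
    have : (a * d) % 2 = 1 := by
      have : a * d = 1 + 2 * (12 * c * j) := by linarith
      omega
    rcases Int.emod_two_eq_zero_or_one a with h | h
    · rw [Int.mul_emod, h] at this; simp at this
    · exact h
  rw [dedekindRoot_eq_e hc hN]
  have hc' : (c : ℝ) ≠ 0 := by positivity
  generalize J((c : ℤ) | d) = J at *
  -- X' is 0 mod 3 and d + 1 - 2J mod 8; for J = ±1 the expression 9(d-1) + 6(1-J) has both
  -- residues.
  obtain ⟨m, hm⟩ : (24 : ℤ) ∣ X' - (9 * (d - 1) + 6 * (1 - J)) := by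
    rcases hJ with rfl | rfl <;> omega
  -- Reciprocity multiplied by a, with ad replaced by 1 + 24cj, solves for N modulo 24c times an
  -- integer.
  have hNeq : N = d + a + a * c ^ 2 - 12 * c + 9 * a * c - 6 * a * c * (1 - J) + 24 * c *
      (j * (d - N - 12 * c) - a * m) := by
    linear_combination a * hrec' - a * c * hm + (-12 * c - N + d) * hj
  -- As a is odd, the sign can be absorbed into the exponential with a factor a in the exponent.
  have hJe : (-(J : ℂ)) = e (1 / 2 + a * (1 - J) / 4) := by
    rcases hJ with rfl | rfl
    · norm_num [e_half]
    · have : (1 / 2 + (a : ℝ) * (1 - ((-1 : ℤ) : ℝ)) / 4) = ((a + 1 : ℤ) : ℝ) / 2 := by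
        push_cast; ring
      rw [this, e_half_int, Even.neg_one_zpow]
      · norm_num
      · rw [Int.even_iff]; omega
  rw [hJe, ← e_add, ← e_add]
  apply e_eq_of_sub_eq_int (-(j * (d - N - 12 * c) - a * m))
  have hNr := congrArg (fun z : ℤ => (z : ℝ)) hNeq
  push_cast at hNr ⊢
  field_simp
  linear_combination (-8) * hNr

/-! ### Roots of unity of order p and sines -/

theorem e_eq_one_iff (x : ℝ) : e x = 1 ↔ ∃ m : ℤ, x = m := by
  constructor
  · intro h
    rw [e, Complex.exp_eq_one_iff] at h
    obtain ⟨m, hm⟩ := h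
    refine ⟨m, ?_⟩
    have h2 : (2 * Real.pi * Complex.I : ℂ) ≠ 0 := Complex.two_pi_I_ne_zero
    have : (x : ℂ) = m := by
      apply mul_left_cancel₀ h2
      rw [hm]; ring
    exact_mod_cast this
  · rintro ⟨m, rfl⟩
    exact e_int m

/-- The root of unity `e(k/p)`. -/
noncomputable def zt (p : ℕ) (k : ℤ) : ℂ := e (k / p)

theorem zt_add (p : ℕ) (k l : ℤ) : zt p (k + l) = zt p k * zt p l := by
  rw [zt, zt, zt, ← e_add]; congr 1; push_cast; ring

theorem zt_zero (p : ℕ) : zt p 0 = 1 := by simp [zt, e_zero]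

theorem zt_congr {p : ℕ} (hp : 0 < p) {k l : ℤ} (h : k ≡ l [ZMOD p]) : zt p k = zt p l := by
  obtain ⟨m, hm⟩ := h.dvd
  apply e_eq_of_sub_eq_int (-m)
  have : (l : ℝ) = k + p * m := by
    have : l = k + p * m := by linarith
    rw [this]; push_cast; ring
  rw [this]; push_cast; field_simp; ring

theorem zt_sub_ne_zero {p : ℕ} (hp : p.Prime) (hp2 : p ≠ 2) {k : ℤ} (hk : ¬ (p : ℤ) ∣ k) :
    zt p k - zt p (-k) ≠ 0 := by
  intro h
  have h1 : zt p (2 * k) = 1 := by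
    rw [two_mul, zt_add]
    nth_rw 2 [sub_eq_zero.1 h]
    rw [← zt_add, add_neg_cancel, zt_zero]
  obtain ⟨m, hm⟩ := (e_eq_one_iff _).1 h1
  have hp0 : (p : ℝ) ≠ 0 := by exact_mod_cast hp.ne_zero
  have : (2 * k : ℤ) = m * p := by
    rw [div_eq_iff hp0] at hm
    exact_mod_cast hm
  have hd : (p : ℤ) ∣ 2 * k := ⟨m, by linarith⟩
  rcases (Nat.prime_iff_prime_int.1 hp).dvd_or_dvd hd with h2 | h2
  · exact hp2 ((Nat.prime_dvd_prime_iff_eq hp Nat.prime_two).1 (by exact_mod_cast h2))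
  · exact hk h2

/-- Telescoping form of sin(mx)/sin(x) as a Laurent polynomial; this is what later removes the sines
from the denominators. -/
theorem sum_zt_mul_sub (p : ℕ) (k : ℤ) (m : ℕ) :
    (∑ j ∈ range m, zt p (k * (m - 1 - 2 * j))) * (zt p k - zt p (-k)) =
      zt p (k * m) - zt p (-(k * m)) := by
  have h : ∀ j ∈ range m, zt p (k * (m - 1 - 2 * j)) * (zt p k - zt p (-k)) =
      zt p (k * (m - 2 * j)) - zt p (k * (m - 2 * ((j + 1 : ℕ) : ℤ))) := by
    intro j _
    rw [mul_sub, ← zt_add, ← zt_add]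
    congr 2 <;> push_cast <;> ring
  rw [sum_mul, sum_congr rfl h, sum_range_sub' (fun j : ℕ => zt p (k * (m - 2 * (j : ℤ))))]
  congr 2
  ring

theorem sum_zt_eq_zero {p : ℕ} (hp : 0 < p) {k : ℤ} (hk : ¬ (p : ℤ) ∣ k) :
    ∑ t ∈ range p, zt p (k * t) = 0 := by
  have h1 : zt p k ≠ 1 := by
    intro h
    obtain ⟨m, hm⟩ := (e_eq_one_iff _).1 h
    have hp0 : (p : ℝ) ≠ 0 := by positivity
    rw [div_eq_iff hp0] at hm
    exact hk ⟨m, by rw [mul_comm]; exact_mod_cast hm⟩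
  have h : ∀ t ∈ range p, zt p (k * t) * (zt p k - 1) =
      zt p (k * ((t + 1 : ℕ) : ℤ)) - zt p (k * (t : ℤ)) := by
    intro t _
    rw [mul_sub, ← zt_add, mul_one]
    congr 2; push_cast; ring
  have h2 : (∑ t ∈ range p, zt p (k * t)) * (zt p k - 1) = 0 := by
    rw [sum_mul, sum_congr rfl h, sum_range_sub (fun t : ℕ => zt p (k * (t : ℤ))), sub_eq_zero]
    apply zt_congr hp
    exact Int.modEq_iff_dvd.2 ⟨-k, by push_cast; ring⟩
  exact (mul_eq_zero.1 h2).resolve_right (sub_ne_zero.2 h1)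

theorem sin_eq_e (x : ℝ) :
    (Real.sin (Real.pi * x) : ℂ) = (e (x / 2) - e (-(x / 2))) / (2 * Complex.I) := by
  rw [Complex.ofReal_sin, Complex.sin, e, e]
  have hI := Complex.I_ne_zero
  have e1 : 2 * (Real.pi : ℂ) * Complex.I * ((x / 2 : ℝ) : ℂ) =
      ((Real.pi * x : ℝ) : ℂ) * Complex.I := by
    push_cast; ring
  have e2 : 2 * (Real.pi : ℂ) * Complex.I * ((-(x / 2) : ℝ) : ℂ) =
      -((Real.pi * x : ℝ) : ℂ) * Complex.I := by
    push_cast; ring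
  rw [e1, e2, eq_div_iff (by simp)]
  linear_combination (Complex.exp (-((Real.pi * x : ℝ) : ℂ) * Complex.I) -
    Complex.exp (((Real.pi * x : ℝ) : ℂ) * Complex.I)) * Complex.I_sq

/-- `sin(πk/p)` in terms of `e(1/p)` for odd `p`. -/
theorem sin_eq_zt {p : ℕ} (hp : p % 2 = 1) (k : ℤ) :
    (Real.sin (Real.pi * (k / p)) : ℂ) =
      (-1) ^ k * (zt p (((p + 1) / 2 : ℕ) * k) - zt p (-(((p + 1) / 2 : ℕ) * k))) /
        (2 * Complex.I) := by
  have hp0 : (p : ℝ) ≠ 0 := by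
    have : p ≠ 0 := by omega
    exact_mod_cast this
  -- h is the inverse of 2 modulo p; it turns the half-exponent k/(2p) into hk/p up to the sign
  -- (-1)^k.
  obtain ⟨h, hh⟩ : ∃ h, (p + 1) / 2 = h ∧ 2 * h = p + 1 := ⟨(p + 1) / 2, rfl, by omega⟩
  have hhr : (2 : ℝ) * h = p + 1 := by exact_mod_cast hh.2
  rw [hh.1, sin_eq_e, mul_sub, zt, zt, ← e_half_int, ← e_add, ← e_add]
  congr 2
  · apply e_eq_of_sub_eq_int (-k)
    push_cast; field_simp
    linear_combination (-(k : ℝ)) * hhr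
  · apply congrArg
    push_cast; field_simp
    linear_combination (k : ℝ) * hhr

/-- The factor of the summand of `SInfInf` which depends on the inverse `a`. -/
noncomputable def sinKernel (p ℓ c : ℕ) (a : ℤ) : ℂ :=
  (-1 : ℂ) ^ (ℓ * c) * e (-(3 * (c : ℝ) * (a : ℝ) * (ℓ : ℝ) ^ 2 / (2 * (p : ℝ) ^ 2)))
    / (Real.sin (Real.pi * (a : ℝ) * (ℓ : ℝ) / (p : ℝ)) : ℂ)

/-- Both the sine and the exponential change by (-1)^(Amℓ) under a ↦ a + pAm. Hence the inverse of d
may be taken modulo 24c, as the closed form of the multiplier requires. -/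
theorem sinKernel_congr {p : ℕ} (hp : 0 < p) (ℓ A : ℕ) {a a' : ℤ} (h : a ≡ a' [ZMOD (p * A : ℕ)]) :
    sinKernel p ℓ (p * A) a = sinKernel p ℓ (p * A) a' := by
  obtain ⟨m, hm⟩ := h.dvd
  have hp0 : (p : ℝ) ≠ 0 := by positivity
  have ha : a' = a + p * A * m := by push_cast at hm; linarith
  have h1 : Real.sin (Real.pi * (a' : ℝ) * ℓ / p) =
      (-1) ^ (A * m * ℓ : ℤ) * Real.sin (Real.pi * (a : ℝ) * ℓ / p) := by
    rw [← Real.sin_add_int_mul_pi]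
    congr 1
    rw [ha]; push_cast; field_simp
  have h2 : e (-(3 * ((p * A : ℕ) : ℝ) * (a' : ℝ) * (ℓ : ℝ) ^ 2 / (2 * (p : ℝ) ^ 2))) =
      e (-(3 * ((p * A : ℕ) : ℝ) * (a : ℝ) * (ℓ : ℝ) ^ 2 / (2 * (p : ℝ) ^ 2))) *
        (-1) ^ (A * m * ℓ : ℤ) := by
    have : (-1 : ℂ) ^ (A * m * ℓ : ℤ) = (-1) ^ (-3 * A ^ 2 * m * ℓ ^ 2 : ℤ) := by
      -- The parity comes from the product of consecutive integers Aℓ(Aℓ + 1).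
      have key : Even (A * m * ℓ - -3 * A ^ 2 * m * ℓ ^ 2 : ℤ) := by
        have : (A * m * ℓ - -3 * A ^ 2 * m * ℓ ^ 2 : ℤ) =
            m * ((A * ℓ) * (A * ℓ + 1)) + 2 * (m * (A * ℓ) ^ 2) := by ring
        rw [this]
        exact ((Int.even_mul_succ_self _).mul_left _).add (even_two_mul _)
      have e1 := key.neg_one_zpow (α := ℂ)
      rw [zpow_sub₀ (by norm_num)] at e1
      exact (div_eq_one_iff_eq (zpow_ne_zero _ (by norm_num))).1 e1
    rw [this, ← e_half_int, ← e_add]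
    congr 1
    rw [ha]; push_cast; field_simp; ring
  unfold sinKernel
  rw [h1, h2]
  push_cast
  have hz : ((-1 : ℂ) ^ (A * m * ℓ : ℤ)) ≠ 0 := zpow_ne_zero _ (by norm_num)
  rw [← mul_div_mul_left _ (Complex.sin (Real.pi * a * ℓ / p)) hz]
  congr 1
  ring

/-- For odd a all the half-integral exponents combine into p-th roots of unity, leaving only the
sign (-1)^ℓ, which cancels against the one in `sinPi_eq_zt`. -/
theorem sinKernel_eq_zt {p : ℕ} (hp : p % 2 = 1) (ℓ A : ℕ) {a : ℤ} (ha : a % 2 = 1) :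
    sinKernel p ℓ (p * A) a =
      2 * Complex.I * (-1) ^ ℓ * zt p (-(3 * ((p + 1) / 2 : ℕ) * A * ℓ ^ 2 * a)) /
        (zt p (((p + 1) / 2 : ℕ) * (a * ℓ)) - zt p (-(((p + 1) / 2 : ℕ) * (a * ℓ)))) := by
  have hp0 : (p : ℝ) ≠ 0 := by
    have : p ≠ 0 := by omega
    exact_mod_cast this
  obtain ⟨h, hh⟩ : ∃ h, (p + 1) / 2 = h ∧ 2 * h = p + 1 := ⟨(p + 1) / 2, rfl, by omega⟩
  have hhr : (2 : ℝ) * h = p + 1 := by exact_mod_cast hh.2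
  have h1 := sin_eq_zt hp (a * ℓ)
  rw [show Real.pi * (((a * ℓ : ℤ) : ℝ) / p) = Real.pi * (a : ℝ) * ℓ / p by push_cast; ring] at h1
  have h2 : (-1 : ℂ) ^ (ℓ * (p * A)) *
      e (-(3 * ((p * A : ℕ) : ℝ) * (a : ℝ) * (ℓ : ℝ) ^ 2 / (2 * (p : ℝ) ^ 2)))
      = zt p (-(3 * h * A * ℓ ^ 2 * a)) := by
    rw [← zpow_natCast, ← e_half_int, ← e_add, zt]
    obtain ⟨b, hb⟩ : ∃ b, a = 2 * b + 1 := ⟨a / 2, by omega⟩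
    obtain ⟨q, hq⟩ : ∃ q, p = 2 * q + 1 := ⟨p / 2, by omega⟩
    obtain ⟨r, hr⟩ := Int.even_mul_succ_self ℓ
    apply e_eq_of_sub_eq_int (ℓ * q * A + A * r + A * ℓ ^ 2 * (3 * b + 1))
    have hrr : (ℓ : ℝ) * (ℓ + 1) = r + r := by exact_mod_cast hr
    have hbr : (a : ℝ) = 2 * b + 1 := by exact_mod_cast hb
    have hqr : (p : ℝ) = 2 * q + 1 := by exact_mod_cast hq
    push_cast
    field_simp
    linear_combination 3 * A * ℓ ^ 2 * a * hhr + A * p * ℓ * hqr + p * A * hrr +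
      3 * p * A * ℓ ^ 2 * hbr
  rw [sinKernel, h1, h2, hh.1, zpow_mul, (Int.odd_iff.2 ha).neg_one_zpow, zpow_natCast]
  have hs : ((-1 : ℂ) ^ ℓ) * (-1) ^ ℓ = 1 := by rw [← mul_pow]; simp
  have hs0 : ((-1 : ℂ) ^ ℓ) ≠ 0 := pow_ne_zero _ (by norm_num)
  rw [div_div_eq_mul_div, mul_comm (zt p _) (2 * Complex.I), mul_assoc (2 * Complex.I),
    ← mul_div_mul_left _ (_ - _) hs0]
  congr 1
  linear_combination (-(2 * Complex.I * zt p (-(3 * h * A * ℓ ^ 2 * a)))) * hs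

/-! ### Kloosterman sums over `ZMod c`, split along progressions -/

theorem sum_range_eq_sum_zmod {c : ℕ} [NeZero c] (f : ℕ → ℂ) :
    ∑ d ∈ range c, f d = ∑ z : ZMod c, f z.val := by
  obtain ⟨k, rfl⟩ := Nat.exists_eq_succ_of_ne_zero (NeZero.ne c)
  exact (Fin.sum_univ_eq_sum_range f (k + 1)).symm

open Classical in
/-- The summand of `SInfInf`, as a function on `ZMod c` vanishing off the units. -/
noncomputable def infTerm (p ℓ : ℕ) (n : ℤ) (c : ℕ) (z : ZMod c) : ℂ :=
  if IsUnit z then sinKernel p ℓ c (z⁻¹).val * dedekindRoot (z.val : ℤ) c * e (n * z.val / c) else 0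

theorem e_mul_div_congr {c : ℕ} (hc : 0 < c) (n : ℤ) {d d' : ℤ} (h : d ≡ d' [ZMOD c]) :
    e (n * d / c) = e (n * d' / c) := by
  have := zt_congr hc (h.mul_left n)
  simpa [zt] using this

theorem infTerm_intCast {p : ℕ} (hp : 0 < p) (ℓ : ℕ) (n : ℤ) {A : ℕ} (hA : 0 < A) {a d : ℤ}
    (h : a * d ≡ 1 [ZMOD (p * A : ℕ)]) :
    infTerm p ℓ n (p * A) (d : ZMod (p * A)) =
      sinKernel p ℓ (p * A) a * dedekindRoot d (p * A) * e (n * d / (p * A : ℕ)) := by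
  have hc : 0 < p * A := Nat.mul_pos hp hA
  have : NeZero (p * A) := ⟨hc.ne'⟩
  have h1 : (a : ZMod (p * A)) * d = 1 := by
    rw [← ZMod.intCast_eq_intCast_iff] at h
    simpa using h
  have hu : IsUnit (d : ZMod (p * A)) := IsUnit.of_mul_eq_one _ ((mul_comm _ _).trans h1)
  have hinv : (d : ZMod (p * A))⁻¹ = a := by
    have := ZMod.mul_inv_of_unit _ hu
    calc (d : ZMod (p * A))⁻¹ = (a * d) * (d : ZMod (p * A))⁻¹ := by rw [h1, one_mul]
      _ = a := by rw [mul_assoc, this, mul_one]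
  have hv : ∀ x : ℤ, (((x : ZMod (p * A)).val : ℕ) : ℤ) ≡ x [ZMOD (p * A : ℕ)] := by
    intro x
    rw [← ZMod.intCast_eq_intCast_iff]
    simp
  rw [infTerm, if_pos hu, hinv, sinKernel_congr hp ℓ A (hv a), dedekindRoot_congr (hv d)]
  congr 1
  have := e_mul_div_congr hc n (hv d)
  simpa using this

theorem infTerm_of_not_isUnit (p ℓ : ℕ) (n : ℤ) {c : ℕ} {z : ZMod c} (h : ¬ IsUnit z) :
    infTerm p ℓ n c z = 0 := if_neg h

theorem SInfInf_eq_sum (p ℓ : ℕ) (n : ℤ) {c : ℕ} [NeZero c] :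
    SInfInf p ℓ n c = e (-(1 / 8)) * ∑ z : ZMod c, infTerm p ℓ n c z := by
  rw [SInfInf, sum_filter, sum_range_eq_sum_zmod]
  congr 1
  refine sum_congr rfl fun z _ => ?_
  have hu : Nat.Coprime z.val c ↔ IsUnit z := by
    rw [← ZMod.isUnit_iff_coprime, ZMod.natCast_zmod_val]
  by_cases h : IsUnit z
  · rw [if_pos (hu.2 h), infTerm, if_pos h]
    have : (range c).filter (fun a => a * z.val ≡ 1 [MOD c]) = {(z⁻¹).val} := by
      ext a
      simp only [mem_filter, mem_range, mem_singleton]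
      rw [← ZMod.natCast_eq_natCast_iff]
      push_cast
      rw [ZMod.natCast_zmod_val]
      constructor
      · rintro ⟨ha, h1⟩
        have : (a : ZMod c) = z⁻¹ := by
          calc (a : ZMod c) = a * (z * z⁻¹) := by rw [ZMod.mul_inv_of_unit _ h, mul_one]
            _ = z⁻¹ := by rw [← mul_assoc, h1, one_mul]
        rw [← this, ZMod.val_natCast, Nat.mod_eq_of_lt ha]
      · rintro rfl
        refine ⟨ZMod.val_lt _, ?_⟩
        rw [ZMod.natCast_zmod_val, ZMod.inv_mul_of_unit _ h]
    rw [this, sum_singleton]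
    simp [sinKernel, dedekindRoot]
  · rw [if_neg (mt hu.1 h), infTerm, if_neg h]

theorem coprime_twentyFour {p : ℕ} (hp : p.Prime) (hp5 : 5 ≤ p) : p.Coprime 24 := by
  rw [Nat.Prime.coprime_iff_not_dvd hp]
  intro h
  have : p ∣ 2 ^ 3 * 3 := h
  rcases (Nat.Prime.dvd_mul hp).1 this with h | h
  · have := Nat.le_of_dvd (by norm_num) (hp.dvd_of_dvd_pow h); omega
  · have := Nat.le_of_dvd (by norm_num) h; omega

/-- A sum over `ZMod (p * A)` along the progressions of difference `24 * A`. -/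
theorem sum_zmod_eq_sum_fibre {p A : ℕ} [NeZero A] [NeZero (p * A)] (hp : p.Prime) (hp5 : 5 ≤ p)
    (f : ZMod (p * A) → ℂ) (g : ZMod A → ℤ) (hg : Function.Injective fun r => (g r : ZMod A)) :
    ∑ z, f z = ∑ r, ∑ t ∈ range p, f ((g r + 24 * A * t : ℤ) : ZMod (p * A)) := by
  have hA : 0 < A := Nat.pos_of_ne_zero (NeZero.ne A)
  have hp24 : IsCoprime (p : ℤ) 24 := by
    exact_mod_cast Nat.isCoprime_iff_coprime.2 (coprime_twentyFour hp hp5)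
  let φ : ZMod A × Fin p → ZMod (p * A) := fun x =>
    ((g x.1 + 24 * A * (x.2 : ℕ) : ℤ) : ZMod (p * A))
  have hφ : Function.Bijective φ := by
    rw [Fintype.bijective_iff_injective_and_card]
    refine ⟨?_, by simp [ZMod.card, mul_comm]⟩
    rintro ⟨r, t⟩ ⟨r', t'⟩ h
    have h' := (ZMod.intCast_eq_intCast_iff_dvd_sub _ _ _).1 h
    have hr : r = r' := by
      apply hg
      rw [← sub_eq_zero, ← neg_eq_zero, neg_sub]
      have h2 : (A : ℤ) ∣ _ := (Int.natCast_dvd_natCast.2 (Dvd.intro_left p rfl)).trans h'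
      have := (ZMod.intCast_zmod_eq_zero_iff_dvd _ _).2 h2
      push_cast at this
      simpa using this
    subst hr
    have h3 : (p : ℤ) ∣ 24 * ((t' : ℕ) - (t : ℕ) : ℤ) := by
      have h4 : ((p * A : ℕ) : ℤ) ∣ A * (24 * ((t' : ℕ) - (t : ℕ) : ℤ)) := by
        convert h' using 1; push_cast; ring
      rw [mul_comm p A, Nat.cast_mul] at h4
      exact Int.dvd_of_mul_dvd_mul_left (by positivity) h4
    have h5 := hp24.dvd_of_dvd_mul_left h3
    have h6 : t = t' := by
      have h7 : ((t' : ℕ) - (t : ℕ) : ℤ) = 0 := by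
        apply Int.eq_zero_of_abs_lt_dvd h5
        have := t.2; have := t'.2
        rw [abs_lt]; omega
      ext; omega
    rw [h6]
  rw [← hφ.sum_comp, Fintype.sum_prod_type]
  refine sum_congr rfl fun r _ => ?_
  exact Fin.sum_univ_eq_sum_range (fun t : ℕ => f ((g r + 24 * A * (t : ℤ) : ℤ) : ZMod (p * A))) p

/-- Units lift along ℤ/M → ℤ/A. With M a multiple of 24 this supplies representatives to which
`dedekindRoot_eq` applies. -/
theorem exists_coprime_lift {A M : ℕ} [NeZero A] (hM : 1 < M) (hAM : A ∣ M) {r : ZMod A}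
    (hr : IsUnit r) : ∃ B : ℕ, B.Coprime M ∧ (B : ZMod A) = r := by
  have : NeZero M := ⟨by omega⟩
  obtain ⟨u, rfl⟩ := hr
  obtain ⟨v, hv⟩ := ZMod.unitsMap_surjective hAM u
  refine ⟨(v : ZMod M).val, ZMod.val_coe_unit_coprime v, ?_⟩
  rw [← hv, ZMod.unitsMap_val, ZMod.natCast_val]

theorem coprime_of_mul_modEq_one {x : ℤ} {y m : ℕ} (h : x * y ≡ 1 [ZMOD m]) : y.Coprime m := by
  rw [← Nat.isCoprime_iff_coprime]
  obtain ⟨k, hk⟩ := h.dvd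
  exact ⟨x, k, by linarith⟩

theorem odd_of_mul_modEq_one {x y : ℤ} {m : ℕ} (h : x * y ≡ 1 [ZMOD (24 * m : ℕ)]) :
    x % 2 = 1 ∧ y % 2 = 1 := by
  have h2 : x * y ≡ 1 [ZMOD 2] := h.of_dvd ⟨12 * m, by push_cast; ring⟩
  have h3 : (x * y) % 2 = 1 := h2
  rw [← Int.odd_iff, Int.odd_mul, Int.odd_iff, Int.odd_iff] at h3
  exact h3

theorem exists_int_inverse {B M : ℕ} (h : B.Coprime M) : ∃ a : ℤ, a * B ≡ 1 [ZMOD M] := by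
  obtain ⟨u, v, huv⟩ := Nat.isCoprime_iff_coprime.2 h
  exact ⟨u, Int.modEq_iff_dvd.2 ⟨v, by linarith⟩⟩

/-- With d = pB + 24At: quadratic reciprocity turns (p/d) into (d/p) = (A/p)(24t/p) up to a sign
depending on d mod 4, while d ≡ pB mod 4A gives (A/d) = (A/p)(A/B). The two factors (A/p) cancel. -/
theorem jacobiSym_mul_progression {p A B t : ℕ} (hp2 : p % 2 = 1)
    (hpA : p.Coprime A) (hB : B % 2 = 1) :
    J(((p * A : ℕ) : ℤ) | p * B + 24 * A * t) =
      J(ZMod.χ₄ ((p * B : ℕ) : ZMod 4) | p) * J((A : ℤ) | B) * J(24 * (t : ℤ) | p) := by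
  set d := p * B + 24 * A * t with hd
  have hpB : (p * B) % 2 = 1 := by rw [Nat.mul_mod, hp2, hB]
  have hd2 : d % 2 = 1 := by
    have : d = p * B + 2 * (12 * A * t) := by rw [hd]; ring
    omega
  have h1 : J((p : ℤ) | d) = J(ZMod.χ₄ ((p * B : ℕ) : ZMod 4) | p) * J((d : ℤ) | p) := by
    rw [jacobiSym.quadratic_reciprocity' (Nat.odd_iff.2 hp2) (Nat.odd_iff.2 hd2), qrSign]
    congr 2
    have : ((d : ℕ) : ZMod 4) = ((p * B : ℕ) : ZMod 4) := by
      rw [ZMod.natCast_eq_natCast_iff, hd]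
      have : p * B + 24 * A * t = p * B + 4 * (6 * A * t) := by ring
      rw [this]
      simp [Nat.ModEq]
    rw [this]
  have h2 : J((A : ℤ) | d) = J((A : ℤ) | p) * J((A : ℤ) | B) := by
    rw [← jacobiSym.mul_right' _ (by omega) (by omega), jacobiSym.mod_right' A (Nat.odd_iff.2 hd2),
      jacobiSym.mod_right' A (Nat.odd_iff.2 hpB)]
    congr 1
    have : d = p * B + 4 * A * (6 * t) := by rw [hd]; ring
    rw [this, Nat.add_mul_mod_self_left]
  have h3 : J((d : ℤ) | p) = J((A : ℤ) | p) * J(24 * (t : ℤ) | p) := by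
    rw [← jacobiSym.mul_left]
    apply jacobiSym.mod_left'
    rw [hd]
    exact Int.modEq_iff_dvd.2 ⟨-B, by push_cast; ring⟩
  have h4 : J((A : ℤ) | p) ^ 2 = 1 := jacobiSym.sq_one (by simpa using hpA.symm)
  rw [Nat.cast_mul, jacobiSym.mul_left, h1, h2, h3]
  linear_combination (J(ZMod.χ₄ ((p * B : ℕ) : ZMod 4) | p) * J((A : ℤ) | B) *
    J(24 * (t : ℤ) | p)) * h4

/-! ### One residue class modulo A when p ∤ A -/

/-- The factor common to all summands of `SInfInf` in one residue class modulo `A`. -/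
noncomputable def classConst (p A B : ℕ) (a n : ℤ) : ℂ :=
  -(J(ZMod.χ₄ ((p * B : ℕ) : ZMod 4) | p) * J((A : ℤ) | B) : ℤ) * e (-((B + a) / (24 * A))) *
    e (-(p * a * (p * A + 9) / 24)) * e (n * B / A)

/-- Taking pB + 24At as representative makes d/(24pA) split as B/(24A) + t/p, and likewise for the
inverse. Each phase then separates into a class constant and a p-th root of unity. -/
theorem infTerm_progression {p A B : ℕ} (hp : p.Prime) (hp5 : 5 ≤ p) (hA : 0 < A) (hpA : ¬ p ∣ A)
    {a : ℤ} (ha : a * (p ^ 2 * B) ≡ 1 [ZMOD (24 * A : ℕ)]) (ℓ t : ℕ) (n s : ℤ)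
    (hts : (24 * A) ^ 2 * t * s ≡ 1 [ZMOD p]) :
    infTerm p ℓ n (p * A) ((p * B + 24 * A * t : ℤ) : ZMod (p * A)) =
      classConst p A B a n * (2 * Complex.I * (-1) ^ ℓ) * (J(24 * (t : ℤ) | p) *
        (zt p (-(t + s) + 24 * n * t - 72 * ((p + 1) / 2 : ℕ) * A ^ 2 * ℓ ^ 2 * s) /
          (zt p (((p + 1) / 2 : ℕ) * ℓ * (24 * A * s)) -
            zt p (-(((p + 1) / 2 : ℕ) * ℓ * (24 * A * s)))))) := by
  have hp0 : 0 < p := hp.pos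
  have hp2 : p % 2 = 1 := (Nat.odd_iff.1 (hp.odd_of_ne_two (by omega)))
  have hpA' : p.Coprime A := (Nat.Prime.coprime_iff_not_dvd hp).2 hpA
  have hp24 := coprime_twentyFour hp hp5
  set d := p * B + 24 * A * t with hd
  -- The inverse of d modulo 24pA by the Chinese remainder theorem: αd is p²aB modulo 24A and
  -- (24A)²ts modulo p.
  set α := p * a + 24 * A * s with hα
  have hdz : ((p * B + 24 * A * t : ℤ)) = (d : ℤ) := by rw [hd]; push_cast; ring
  have hmod : α * d ≡ 1 [ZMOD (24 * (p * A) : ℕ)] := by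
    have e1 : ((24 * (p * A) : ℕ) : ℤ) = ((24 * A : ℕ) : ℤ) * (p : ℤ) := by push_cast; ring
    rw [e1, ← Int.modEq_and_modEq_iff_modEq_mul]
    · constructor
      · refine Int.ModEq.trans ?_ ha
        refine Int.modEq_iff_dvd.2 ⟨-(s * p * B + t * p * a + 24 * A * s * t), ?_⟩
        rw [← hdz, hα]; push_cast; ring
      · refine Int.ModEq.trans ?_ hts
        refine Int.modEq_iff_dvd.2 ⟨-(a * p * B + 24 * A * s * B + 24 * A * a * t), ?_⟩
        rw [← hdz, hα]; ring
    · rw [Int.natAbs_natCast, Int.natAbs_natCast]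
      exact (Nat.Coprime.mul_right hp24 hpA').symm
  have hmod' : α * d ≡ 1 [ZMOD (p * A : ℕ)] :=
    hmod.of_dvd (Int.natCast_dvd_natCast.2 (Dvd.intro_left 24 rfl))
  have hcop : d.Coprime (24 * (p * A)) := coprime_of_mul_modEq_one hmod
  have hα2 : α % 2 = 1 := (odd_of_mul_modEq_one hmod).1
  have hB2 : B % 2 = 1 := by
    have := (odd_of_mul_modEq_one ha).2
    rw [← Int.odd_iff, Int.odd_mul, Int.odd_iff, Int.odd_iff] at this
    omega
  rw [hdz, infTerm_intCast hp0 ℓ n hA hmod', dedekindRoot_eq (Nat.mul_pos hp0 hA) hcop hmod,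
    sinKernel_eq_zt hp2 ℓ A hα2, hd, jacobiSym_mul_progression hp2 hpA' hB2, ← hd, classConst]
  obtain ⟨h, hh⟩ : ∃ h, (p + 1) / 2 = h := ⟨_, rfl⟩
  rw [hh]
  have hp0' : (p : ℝ) ≠ 0 := by positivity
  have hA0' : (A : ℝ) ≠ 0 := by positivity
  have hdr : (d : ℝ) = p * B + 24 * A * t := by rw [hd]; push_cast; ring
  have hαr : (α : ℝ) = p * a + 24 * A * s := by rw [hα]; push_cast; ring
  have z1 : zt p (h * (α * ℓ)) = zt p (h * ℓ * (24 * A * s)) :=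
    zt_congr hp0 (Int.modEq_iff_dvd.2 ⟨-(h * a * ℓ), by rw [hα]; ring⟩)
  have z2 : zt p (-(h * (α * ℓ))) = zt p (-(h * ℓ * (24 * A * s))) :=
    zt_congr hp0 (Int.modEq_iff_dvd.2 ⟨(h * a * ℓ), by rw [hα]; ring⟩)
  have z3 : zt p (-(3 * h * A * ℓ ^ 2 * α)) = zt p (-(72 * h * A ^ 2 * ℓ ^ 2 * s)) :=
    zt_congr hp0 (Int.modEq_iff_dvd.2 ⟨3 * h * A * ℓ ^ 2 * a, by rw [hα]; ring⟩)
  have z4 : e (-(((d : ℤ) + α) / (24 * ((p * A : ℕ) : ℝ)))) =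
      e (-((B + a) / (24 * A))) * zt p (-(t + s)) := by
    rw [zt, ← e_add]; congr 1
    push_cast
    rw [hdr, hαr]
    field_simp
    ring
  have z5 : e (-(α * (((p * A : ℕ) : ℝ) + 9) / 24)) = e (-(p * a * (p * A + 9) / 24)) := by
    apply e_eq_of_sub_eq_int (-(A * s * (p * A + 9)))
    push_cast
    rw [hαr]; ring
  have z6 : e (n * (d : ℤ) / (p * A : ℕ)) = e (n * B / A) * zt p (24 * n * t) := by
    rw [zt, ← e_add]; congr 1
    push_cast
    rw [hdr]
    field_simp
  push_cast at z4 z5 z6 ⊢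
  rw [z1, z2, z3, z4, z5, z6, sub_eq_add_neg (_ + _) (72 * (h : ℤ) * _ * _ * _), zt_add, zt_add]
  ring

/-! ### Laurent polynomials at a root of unity -/

/-- The value at `e(1/p)` of the Laurent polynomial given by a list of pairs
(coefficient, exponent). -/
noncomputable def evalZt (p : ℕ) (L : List (ℤ × ℤ)) : ℂ := (L.map fun x => (x.1 : ℂ) * zt p x.2).sum

theorem evalZt_append (p : ℕ) (L M : List (ℤ × ℤ)) :
    evalZt p (L ++ M) = evalZt p L + evalZt p M := by
  simp [evalZt]

/-- The product of two Laurent polynomials. -/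
def mulTerms (L M : List (ℤ × ℤ)) : List (ℤ × ℤ) :=
  L.flatMap fun x => M.map fun y => (x.1 * y.1, x.2 + y.2)

theorem evalZt_flatMap {α : Type*} (p : ℕ) (l : List α) (f : α → List (ℤ × ℤ)) :
    evalZt p (l.flatMap f) = (l.map fun x => evalZt p (f x)).sum := by
  induction l with
  | nil => simp [evalZt]
  | cons x l ih => rw [List.flatMap_cons, evalZt_append, ih]; simp

theorem evalZt_mulTerms (p : ℕ) (L M : List (ℤ × ℤ)) :
    evalZt p (mulTerms L M) = evalZt p L * evalZt p M := by
  rw [mulTerms, evalZt_flatMap]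
  conv_rhs => rw [evalZt, ← List.sum_map_mul_right]
  congr 1
  refine List.map_congr_left fun x _ => ?_
  rw [evalZt, evalZt, ← List.sum_map_mul_left, List.map_map]
  congr 1
  refine List.map_congr_left fun y _ => ?_
  simp only [Function.comp, zt_add]
  push_cast; ring

/-- The sum of the coefficients at exponents congruent to `i` modulo `p`. -/
def coeffMod (p : ℕ) (L : List (ℤ × ℤ)) (i : ℕ) : ℤ :=
  (L.map fun x : ℤ × ℤ => if (x.2 % p).toNat = i then x.1 else 0).sum

/-- Whether all coefficients modulo `X ^ p - 1` agree. -/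
def isConstMod (p : ℕ) (L : List (ℤ × ℤ)) : Bool :=
  (List.range p).all fun i => coeffMod p L i == coeffMod p L 0

theorem evalZt_eq_sum_coeffMod {p : ℕ} (hp : 0 < p) (L : List (ℤ × ℤ)) :
    evalZt p L = ∑ i ∈ range p, (coeffMod p L i : ℂ) * zt p i := by
  induction L with
  | nil => simp [evalZt, coeffMod]
  | cons x L ih =>
    have h0 : (x.2 % p).toNat < p := by
      have := Int.emod_lt_of_pos x.2 (by omega : (0 : ℤ) < p)
      omega
    have h1 : ∀ i, coeffMod p (x :: L) i =
        (if (x.2 % p).toNat = i then x.1 else 0) + coeffMod p L i := by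
      intro i; simp [coeffMod]
    have h2 : evalZt p (x :: L) = (x.1 : ℂ) * zt p x.2 + evalZt p L := by simp [evalZt]
    rw [h2, ih]
    simp only [h1, Int.cast_add, add_mul, sum_add_distrib]
    congr 1
    rw [sum_eq_single_of_mem (x.2 % p).toNat (by simpa using h0)]
    · rw [if_pos rfl]
      congr 1
      apply zt_congr hp
      rw [Int.toNat_of_nonneg (Int.emod_nonneg _ (by omega))]
      exact (Int.mod_modEq _ _).symm
    · intro i _ hi
      rw [if_neg hi.symm]; simp

/-- Equal coefficients modulo X^p - 1 mean a multiple of 1 + X + ... + X^(p-1), which vanishes at ζ.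
This makes vanishing decidable by integer arithmetic. -/
theorem evalZt_eq_zero {p : ℕ} (hp : 1 < p) {L : List (ℤ × ℤ)} (h : isConstMod p L = true) :
    evalZt p L = 0 := by
  rw [evalZt_eq_sum_coeffMod (by omega)]
  have h1 : ∀ i ∈ range p, (coeffMod p L i : ℂ) * zt p i = coeffMod p L 0 * zt p (1 * i) := by
    intro i hi
    simp only [isConstMod, List.all_eq_true, List.mem_range, beq_iff_eq] at h
    rw [h i (by simpa using hi), one_mul]
  rw [sum_congr rfl h1, ← mul_sum, sum_zt_eq_zero (by omega), mul_zero]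
  intro hd
  have := Int.le_of_dvd one_pos hd
  omega

/-- The Laurent polynomial `(X^q - X^{-q}) / (X^{qy} - X^{-qy})` where `y m ≡ 1`. -/
def sinRatio (q y m : ℕ) : List (ℤ × ℤ) :=
  (List.range m).map fun j : ℕ => (1, (q * y : ℤ) * (m - 1 - 2 * j))

theorem evalZt_map_range (p m : ℕ) (f : ℕ → ℤ × ℤ) :
    evalZt p ((List.range m).map f) = ∑ j ∈ range m, ((f j).1 : ℂ) * zt p (f j).2 := by
  rw [evalZt, List.map_map]
  induction m with
  | zero => simp
  | succ m ih => rw [List.range_succ, List.map_append, List.sum_append, ih, sum_range_succ]; simp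

theorem evalZt_sinRatio {p : ℕ} (hp : p.Prime) (hp2 : p ≠ 2) {q y m : ℕ} {z : ℤ}
    (hq : ¬ p ∣ q) (hym : y * m ≡ 1 [MOD p]) (hz : z ≡ y [ZMOD p]) :
    evalZt p (sinRatio q y m) = (zt p q - zt p (-q)) / (zt p (q * z) - zt p (-(q * z))) := by
  have hpi := Nat.prime_iff_prime_int.1 hp
  have hy : ¬ (p : ℤ) ∣ y := by
    intro h
    have h1 : p ∣ y * m := Dvd.dvd.mul_right (by exact_mod_cast h) _
    have h2 := (hym.dvd_iff (dvd_refl p)).1 h1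
    exact hp.one_lt.ne' (Nat.dvd_one.1 h2)
  have hqy : ¬ (p : ℤ) ∣ q * y := by
    intro h
    rcases hpi.dvd_or_dvd h with h | h
    · exact hq (by exact_mod_cast h)
    · exact hy h
  have z1 : zt p (q * z) = zt p (q * y) := zt_congr hp.pos (hz.mul_left _)
  have z2 : zt p (-(q * z)) = zt p (-(q * y)) := zt_congr hp.pos (hz.mul_left _).neg
  rw [z1, z2, eq_div_iff (zt_sub_ne_zero hp hp2 hqy), sinRatio, evalZt_map_range]
  simp only [Int.cast_one, one_mul]
  rw [sum_zt_mul_sub]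
  have h3 : (q * y * m : ℤ) ≡ q [ZMOD p] := by
    have : ((y * m : ℕ) : ℤ) ≡ (1 : ℕ) [ZMOD p] := Int.natCast_modEq_iff.2 hym
    have := this.mul_left (q : ℤ)
    push_cast at this
    rw [mul_one] at this
    rw [mul_assoc]
    exact this
  rw [zt_congr hp.pos h3, zt_congr hp.pos h3.neg]

theorem sinPi_eq_zt {p : ℕ} (hp2 : p % 2 = 1) (ℓ : ℕ) :
    sinPi p ℓ = (-1) ^ ℓ * (zt p (((p + 1) / 2 * ℓ : ℕ)) - zt p (-(((p + 1) / 2 * ℓ : ℕ)))) /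
        (2 * Complex.I) := by
  have := sin_eq_zt hp2 ℓ
  rw [zpow_natCast] at this
  push_cast at this ⊢
  rw [← this, sinPi]
  push_cast
  ring_nf

theorem neg_one_pow_mul_self (ℓ : ℕ) : ((-1 : ℂ) ^ ℓ) * (-1) ^ ℓ = 1 := by
  rw [← mul_pow]; simp

/-- The inverse of `(24A)² t` modulo a prime `p`. -/
def invSq (p A t : ℕ) : ℕ := ((24 * A) ^ 2 * t) ^ (p - 2) % p

theorem mul_pow_sub_two {p x : ℕ} (hp : p.Prime) (hx : ¬ p ∣ x) :
    x * (x ^ (p - 2) % p) ≡ 1 [MOD p] := by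
  have hp2 := hp.two_le
  have h1 : x * (x ^ (p - 2) % p) ≡ x * x ^ (p - 2) [MOD p] := (Nat.mod_modEq _ _).mul_left x
  refine h1.trans ?_
  rw [← pow_succ', show p - 2 + 1 = p - 1 by omega, ← Nat.totient_prime hp]
  exact Nat.ModEq.pow_totient ((Nat.Prime.coprime_iff_not_dvd hp).2 hx).symm

/-- Euler's criterion. -/
def euler (p x : ℕ) : ℤ :=
  if x % p = 0 then 0 else if x ^ ((p - 1) / 2) % p = 1 then 1 else -1

theorem jacobiSym_eq_euler {p : ℕ} (hp : p.Prime) (hp2 : p ≠ 2) (x : ℕ) :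
    J((x : ℤ) | p) = euler p x := by
  have : Fact p.Prime := ⟨hp⟩
  rw [← jacobiSym.legendreSym.to_jacobiSym, euler]
  split_ifs with h1 h2
  · rw [legendreSym.eq_zero_iff]
    simpa using (ZMod.natCast_eq_zero_iff _ _).2 (Nat.dvd_of_mod_eq_zero h1)
  · have hx : ((x : ℤ) : ZMod p) ≠ 0 := by
      simpa [ZMod.natCast_eq_zero_iff, Nat.dvd_iff_mod_eq_zero] using h1
    have h3 := legendreSym.eq_pow p x
    rcases legendreSym.eq_one_or_neg_one p hx with h | h
    · exact h
    · exfalso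
      have : ((x ^ ((p - 1) / 2) : ℕ) : ZMod p) = (1 : ℕ) := by
        rw [ZMod.natCast_eq_natCast_iff, Nat.ModEq, h2, Nat.mod_eq_of_lt hp.one_lt]
      have e1 : p / 2 = (p - 1) / 2 := by have := hp.eq_two_or_odd; omega
      rw [h, e1] at h3
      push_cast at this h3
      rw [this] at h3
      have : Fact (2 < p) := ⟨by have := hp.two_le; omega⟩
      exact ZMod.neg_one_ne_one h3
  · have hx : ((x : ℤ) : ZMod p) ≠ 0 := by
      simpa [ZMod.natCast_eq_zero_iff, Nat.dvd_iff_mod_eq_zero] using h1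
    have h3 := legendreSym.eq_pow p x
    rcases legendreSym.eq_one_or_neg_one p hx with h | h
    · exfalso
      apply h2
      have e1 : p / 2 = (p - 1) / 2 := by have := hp.eq_two_or_odd; omega
      rw [h, e1] at h3
      have : ((x ^ ((p - 1) / 2) : ℕ) : ZMod p) = (1 : ℕ) := by
        push_cast at h3 ⊢
        exact h3.symm
      rw [ZMod.natCast_eq_natCast_iff, Nat.ModEq, Nat.mod_eq_of_lt hp.one_lt] at this
      exact this
    · exact h

/-- The Laurent polynomial of the class sums of `sin(πℓ/p) SInfInf` when `p ∤ A`. -/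
def classTerms (p ℓ n A : ℕ) : List (ℤ × ℤ) :=
  (List.range p).flatMap fun t =>
    mulTerms [(euler p (24 * t), -(t + invSq p A t) + 24 * n * t
        - 72 * ((p + 1) / 2 : ℕ) * A ^ 2 * ℓ ^ 2 * invSq p A t)]
      -- 24A times `invSq p A t` is inverse to 24At modulo p, so 24At mod p is the number of terms
      -- of the sine ratio.
      (sinRatio ((p + 1) / 2 * ℓ) (24 * A * invSq p A t) (24 * A * t % p))

theorem sum_range_eq_list_sum (p : ℕ) (f : ℕ → ℂ) :
    ((List.range p).map f).sum = ∑ t ∈ range p, f t := by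
  induction p with
  | zero => simp
  | succ m ih => rw [List.range_succ, List.map_append, List.sum_append, ih, sum_range_succ]; simp

theorem sum_infTerm_progression {p A B : ℕ} (hp : p.Prime) (hp5 : 5 ≤ p) (hA : 0 < A)
    (hpA : ¬ p ∣ A) {a : ℤ} (ha : a * (p ^ 2 * B) ≡ 1 [ZMOD (24 * A : ℕ)]) {ℓ : ℕ} (hℓ : ¬ p ∣ ℓ)
    (n : ℤ) (n₀ : ℕ) (hn : n ≡ n₀ [ZMOD p]) :
    sinPi p ℓ * ∑ t ∈ range p, infTerm p ℓ n (p * A) ((p * B + 24 * A * t : ℤ) : ZMod (p * A)) =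
      classConst p A B a n * evalZt p (classTerms p ℓ n₀ (A % p)) := by
  have hp2 : p % 2 = 1 := (Nat.odd_iff.1 (hp.odd_of_ne_two (by omega)))
  have hA0 : (A % p : ℕ) ≡ A [ZMOD p] := by
    exact_mod_cast Int.natCast_modEq_iff.2 (Nat.mod_modEq A p)
  have hp24 : ¬ p ∣ 24 := (Nat.Prime.coprime_iff_not_dvd hp).1 (coprime_twentyFour hp hp5)
  have hh : ¬ p ∣ (p + 1) / 2 := by
    intro h
    have := Nat.le_of_dvd (by omega) h
    omega
  rw [classTerms, evalZt_flatMap, sum_range_eq_list_sum, mul_sum, mul_sum]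
  refine sum_congr rfl fun t ht => ?_
  rw [evalZt_mulTerms]
  -- For t = 0 both sides vanish: pB is not a unit modulo pA, and the Euler symbol of 0 is 0.
  rcases Nat.eq_zero_or_pos t with rfl | ht0
  · rw [infTerm_of_not_isUnit]
    · simp [evalZt, euler]
    · intro hu
      have e1 : ((p * B + 24 * A * (0 : ℕ) : ℤ) : ZMod (p * A)) = ((p * B : ℕ) : ZMod (p * A)) := by
        push_cast; simp
      rw [e1, ZMod.isUnit_iff_coprime] at hu
      have := Nat.Coprime.eq_one_of_dvd (hu.coprime_dvd_left (Dvd.intro _ rfl)) (Dvd.intro _ rfl)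
      exact hp.one_lt.ne' this
  have htp : ¬ p ∣ t := by
    intro h
    have := Nat.le_of_dvd ht0 h
    have := mem_range.1 ht
    omega
  have hA' : ¬ p ∣ A % p := by rwa [Nat.dvd_mod_iff (dvd_refl p)]
  set A₀ := A % p with hA₀
  set s := invSq p A₀ t with hs
  have hs1 : (24 * A₀) ^ 2 * t * s ≡ 1 [MOD p] := by
    apply mul_pow_sub_two hp
    intro h
    rcases (Nat.Prime.dvd_mul hp).1 h with h | h
    · rcases (Nat.Prime.dvd_mul hp).1 (hp.dvd_of_dvd_pow h) with h | h
      · exact hp24 h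
      · exact hA' h
    · exact htp h
  have hs1' : (24 * (A₀ : ℤ)) ^ 2 * t * s ≡ 1 [ZMOD p] := by
    exact_mod_cast Int.natCast_modEq_iff.2 hs1
  have hs2 : (24 * (A : ℤ)) ^ 2 * t * s ≡ 1 [ZMOD p] := by
    refine Int.ModEq.trans ?_ hs1'
    gcongr
  have hym : 24 * A₀ * s * (24 * A₀ * t % p) ≡ 1 [MOD p] := by
    refine ((Nat.mod_modEq _ _).mul_left _).trans ?_
    convert hs1 using 1
    ring
  rw [infTerm_progression hp hp5 hA hpA ha ℓ t n s hs2, sinPi_eq_zt hp2,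
    evalZt_sinRatio hp (by omega) (z := 24 * A * s) _ hym]
  · have e1 : zt p (-(t + s) + 24 * n * t - 72 * ((p + 1) / 2 : ℕ) * A ^ 2 * ℓ ^ 2 * s) =
        zt p (-(t + s) + 24 * n₀ * t - 72 * ((p + 1) / 2 : ℕ) * (A₀ : ℤ) ^ 2 * ℓ ^ 2 * s) := by
      apply zt_congr hp.pos
      gcongr
    have e2 : (J(24 * (t : ℤ) | p)) = euler p (24 * t) := by
      rw [← jacobiSym_eq_euler hp (by omega)]; push_cast; rfl
    rw [e1, e2]
    have e3 : evalZt p [(euler p (24 * t), -((t : ℤ) + s) + 24 * n₀ * t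
        - 72 * ((p + 1) / 2 : ℕ) * (A₀ : ℤ) ^ 2 * ℓ ^ 2 * s)] = euler p (24 * t) *
        zt p (-(t + s) + 24 * n₀ * t - 72 * ((p + 1) / 2 : ℕ) * (A₀ : ℤ) ^ 2 * ℓ ^ 2 * s) := by
      simp [evalZt]
    rw [e3, Nat.cast_mul ((p + 1) / 2)]
    set D := zt p (((p + 1) / 2 : ℕ) * ℓ * (24 * A * s)) -
            zt p (-(((p + 1) / 2 : ℕ) * ℓ * (24 * A * s)))
    have hI : (2 * Complex.I) * (2 * Complex.I)⁻¹ = 1 := mul_inv_cancel₀ (by simp)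
    rw [div_eq_mul_inv, div_eq_mul_inv, div_eq_mul_inv]
    set X := zt p (-(t + s) + 24 * n₀ * t - 72 * ((p + 1) / 2 : ℕ) * (A₀ : ℤ) ^ 2 * ℓ ^ 2 * s)
    set Y := zt p (((p + 1) / 2 : ℕ) * ℓ) - zt p (-(((p + 1) / 2 : ℕ) * ℓ))
    linear_combination (classConst p A B a n * Y * euler p (24 * t) * X * D⁻¹ *
      (2 * Complex.I * (2 * Complex.I)⁻¹)) * neg_one_pow_mul_self ℓ +
      (classConst p A B a n * Y * euler p (24 * t) * X * D⁻¹) * hI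
  · push_cast
    gcongr
  · intro h
    rcases (Nat.Prime.dvd_mul hp).1 h with h | h
    · exact hh h
    · exact hℓ h

/-! ### The sum at the cusp 0 and the Gauss sum modulo 7 -/

theorem e_quarter : e (1 / 4) = Complex.I := by
  have : (2 * Real.pi * Complex.I * ((1 / 4 : ℝ) : ℂ)) = Real.pi / 2 * Complex.I := by
    push_cast; ring
  rw [e, this, Complex.exp_pi_div_two_mul_I]

theorem e_neg_quarter : e (-(1 / 4)) = -Complex.I := by
  rw [e_neg, e_quarter, Complex.inv_I]

theorem SZeroInfSum_eq_sum {A : ℕ} [NeZero A] (hA : ¬ 7 ∣ A) (K n : ℤ) (B b : ZMod A → ℤ)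
    (hB : ∀ r, (B r : ZMod A) = r) (hb : ∀ r, IsUnit r → b r * B r ≡ 1 [ZMOD A])
    [DecidablePred fun r : ZMod A => IsUnit r] :
    SZeroInfSum K n A = ∑ r : ZMod A, if IsUnit r then
      e (-(K * b r / A)) * dedekindRoot (B r) A * e (n * B r / A) else 0 := by
  have hA0 : 0 < A := Nat.pos_of_ne_zero (NeZero.ne A)
  have hcop : Nat.Coprime 7 A := (Nat.Prime.coprime_iff_not_dvd (by norm_num)).2 hA
  rw [SZeroInfSum, sum_filter, sum_range_eq_sum_zmod]
  refine sum_congr rfl fun r _ => ?_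
  have hu : Nat.Coprime r.val A ↔ IsUnit r := by
    rw [← ZMod.isUnit_iff_coprime, ZMod.natCast_zmod_val]
  by_cases h : IsUnit r
  swap
  · rw [if_neg (mt hu.1 h), if_neg h]
  rw [if_pos (hu.2 h), if_pos h]
  have hv : ((r.val : ℕ) : ℤ) ≡ B r [ZMOD A] := by
    rw [← ZMod.intCast_eq_intCast_iff, hB]; simp
  have hbr : (b r : ZMod A) * r = 1 := by
    have := (ZMod.intCast_eq_intCast_iff _ _ _).2 (hb r h)
    push_cast at this
    rwa [hB] at this
  have hrb : r * (b r : ZMod A) = 1 := by rw [mul_comm]; exact hbr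
  -- C must be 0 mod 7 and -B⁻¹ mod A. Since K is an integer, only the residue mod A affects the
  -- summand.
  obtain ⟨C₀, hC7, hCA⟩ := Nat.chineseRemainder hcop 0 (((-b r : ℤ) : ZMod A).val)
  have hC0 : ((C₀ : ℕ) : ZMod A) = -b r := by
    have := (ZMod.natCast_eq_natCast_iff _ _ _).2 hCA
    rw [this]; simp
  have hset : (range (7 * A)).filter
        (fun C : ℕ => 7 ∣ C ∧ (r.val : ℤ) * (C : ℤ) ≡ -1 [ZMOD (A : ℤ)]) = {C₀ % (7 * A)} := by
    ext C
    have key : ((r.val : ℤ) * (C : ℤ) ≡ -1 [ZMOD (A : ℤ)]) ↔ C ≡ C₀ [MOD A] := by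
      rw [← ZMod.intCast_eq_intCast_iff, ← ZMod.natCast_eq_natCast_iff, hC0]
      push_cast
      rw [ZMod.natCast_zmod_val]
      constructor
      · intro h1
        calc (C : ZMod A) = (b r * r) * C := by rw [hbr, one_mul]
          _ = b r * (r * C) := by ring
          _ = -b r := by rw [h1]; ring
      · intro h1
        rw [h1, mul_neg, hrb]
    simp only [mem_filter, mem_range, mem_singleton]
    rw [key]
    have h7 : 7 ∣ C ↔ C ≡ C₀ [MOD 7] := by
      rw [Nat.dvd_iff_mod_eq_zero, Nat.ModEq, show C₀ % 7 = 0 from hC7]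
    rw [h7, Nat.modEq_and_modEq_iff_modEq_mul hcop]
    constructor
    · rintro ⟨h1, h2⟩
      rw [← Nat.mod_eq_of_lt h1]; exact h2
    · rintro rfl
      exact ⟨Nat.mod_lt _ (by omega), Nat.mod_modEq _ _⟩
  rw [hset, sum_singleton]
  have e1 : e (K * ((C₀ % (7 * A) : ℕ) : ℝ) / A) = e (-(K * b r / A)) := by
    have h2 : ((C₀ % (7 * A) : ℕ) : ℤ) ≡ -b r [ZMOD A] := by
      rw [← ZMod.intCast_eq_intCast_iff, Int.cast_neg, ← hC0, Int.cast_natCast,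
        ZMod.natCast_eq_natCast_iff]
      exact (Nat.mod_modEq C₀ (7 * A)).of_dvd (Dvd.intro_left 7 rfl)
    have := e_mul_div_congr hA0 K h2
    rw [← neg_div, ← mul_neg, ← Int.cast_neg, ← this, Int.cast_natCast]
  rw [e1]
  change _ * dedekindRoot ((r.val : ℕ) : ℤ) A * _ = _
  rw [dedekindRoot_congr hv]
  have := e_mul_div_congr hA0 n hv
  rw [← this]; push_cast; rfl

/-- Each summand at the cusp 0 is, up to (-1)^ℓ i and (-1)^T, the class constant of the ∞∞ sum with
p = 7; here 49a is the inverse of B. This is why the two sums can be combined. -/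
theorem zeroTerm_eq {A B : ℕ} (hA : 0 < A) {a : ℤ}
    (ha : a * ((7 : ℕ) ^ 2 * B) ≡ 1 [ZMOD (24 * A : ℕ)])
    (n : ℤ) {ℓ : ℕ} {T K ε : ℤ} (hε : ε = 1 ∨ ε = -1) (hT : A * ℓ = 7 * T + ε)
    (hK : 2 * K = 3 * T ^ 2 + ε * T) :
    (-1) ^ T * (e (-(K * (49 * a : ℤ) / A)) * dedekindRoot (B : ℤ) A * e (n * (B : ℤ) / A)) =
      (-1) ^ ℓ * Complex.I * classConst 7 A B a n := by
  have ha' : (49 * a) * B ≡ 1 [ZMOD (24 * A : ℕ)] := by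
    convert ha using 1; push_cast; ring
  have hcop : B.Coprime (24 * A) := coprime_of_mul_modEq_one ha'
  have h4 : (49 * a * B) % 4 = 1 := by
    have : 49 * a * B ≡ 1 [ZMOD 4] := ha'.of_dvd ⟨6 * A, by push_cast; ring⟩
    exact this
  have ha4 : a % 4 = 1 ∧ (B : ℤ) % 4 = 1 ∨ a % 4 = 3 ∧ (B : ℤ) % 4 = 3 := by
    rw [Int.mul_emod] at h4
    have h1 : 49 * a % 4 = a % 4 := by omega
    have h2 : a % 4 = 0 ∨ a % 4 = 1 ∨ a % 4 = 2 ∨ a % 4 = 3 := by omega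
    have h3 : (B : ℤ) % 4 = 0 ∨ (B : ℤ) % 4 = 1 ∨ (B : ℤ) % 4 = 2 ∨ (B : ℤ) % 4 = 3 := by omega
    rw [h1] at h4
    rcases h2 with h2 | h2 | h2 | h2 <;> rcases h3 with h3 | h3 | h3 | h3 <;>
      rw [h2, h3] at h4 <;> simp_all
  rw [dedekindRoot_eq hA hcop ha', classConst]
  have hA0 : (A : ℝ) ≠ 0 := by positivity
  -- From 7T = Aℓ - ε one gets 2(49K + 2) = A(3Aℓ² + εℓ), so the denominator A cancels and a sign
  -- remains.
  have f1 : e (-(K * (49 * a : ℤ) / A)) * e (-(((B : ℤ) + (49 * a : ℤ)) / (24 * A))) =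
      e (-((B + a) / (24 * A))) * (-1) ^ ((A + 1) * ℓ : ℤ) := by
    have e1 : (-1 : ℂ) ^ ((A + 1) * ℓ : ℤ) = (-1) ^ (-a * (3 * A * ℓ ^ 2 + ε * ℓ)) := by
      have key : Even ((A + 1) * ℓ - -a * (3 * A * ℓ ^ 2 + ε * ℓ) : ℤ) := by
        obtain ⟨x, hx⟩ : ∃ x, a = 2 * x + 1 := ⟨a / 2, by omega⟩
        obtain ⟨y, hy⟩ : Even (1 + ε) := by rcases hε with rfl | rfl <;> decide
        have : ((A + 1) * ℓ - -a * (3 * A * ℓ ^ 2 + ε * ℓ) : ℤ) =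
            A * (ℓ * (ℓ + 1)) + 2 * (x * (3 * A * ℓ ^ 2 + ε * ℓ) + A * ℓ ^ 2 + y * ℓ) := by
          rw [hx]; linear_combination (ℓ : ℤ) * hy
        rw [this]
        exact ((Int.even_mul_succ_self _).mul_left _).add (even_two_mul _)
      have e1 := key.neg_one_zpow (α := ℂ)
      rw [zpow_sub₀ (by norm_num)] at e1
      exact (div_eq_one_iff_eq (zpow_ne_zero _ (by norm_num))).1 e1
    rw [e1, ← e_half_int, ← e_add, ← e_add]
    congr 1
    have hTr : (A : ℝ) * ℓ = 7 * T + ε := by exact_mod_cast hT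
    have hKr : (2 : ℝ) * K = 3 * T ^ 2 + ε * T := by exact_mod_cast hK
    have hε2 : (ε : ℝ) ^ 2 = 1 := by rcases hε with rfl | rfl <;> norm_num
    push_cast
    field_simp
    linear_combination (-(1176 : ℝ)) * a * hKr +
      (72 * a * (A * ℓ + 7 * T + ε) + 24 * ε * a) * hTr + 96 * a * hε2
  -- The exponentials differ by e(-a/4) = ∓i, matched by the Legendre symbol at 7 because a ≡ B mod
  -- 4 and 7 ≡ 3 mod 4.
  have f2 : (J(ZMod.χ₄ ((7 * B : ℕ) : ZMod 4) | 7) : ℂ) * Complex.I *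
      e (-((7 : ℕ) * a * ((7 : ℕ) * A + 9) / 24)) = -e (-((49 * a : ℤ) * (A + 9) / 24)) := by
    have e1 : e (-((7 : ℕ) * a * ((7 : ℕ) * A + 9) / 24)) =
        e (-((49 * a : ℤ) * (A + 9) / 24)) * e (-(a / 4)) := by
      rw [← e_add]
      apply e_eq_of_sub_eq_int (16 * a)
      push_cast; ring
    rw [e1]
    rcases ha4 with ⟨h1, h2⟩ | ⟨h1, h2⟩
    · have h3 : ZMod.χ₄ ((7 * B : ℕ) : ZMod 4) = -1 := ZMod.χ₄_nat_three_mod_four (by omega)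
      have h4 : J(-1 | 7) = -1 := by norm_num
      have h5 : e (-(a / 4)) = -Complex.I := by
        rw [← e_neg_quarter]
        obtain ⟨k, hk⟩ : ∃ k, a = 4 * k + 1 := ⟨a / 4, by omega⟩
        apply e_eq_of_sub_eq_int (-k)
        rw [hk]; push_cast; ring
      rw [h3, h4, h5]
      push_cast
      linear_combination e (-((49 * a : ℝ) * (A + 9) / 24)) * Complex.I_sq
    · have h3 : ZMod.χ₄ ((7 * B : ℕ) : ZMod 4) = 1 := ZMod.χ₄_nat_one_mod_four (by omega)
      have h5 : e (-(a / 4)) = Complex.I := by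
        rw [← e_quarter]
        obtain ⟨k, hk⟩ : ∃ k, a = 4 * k + 3 := ⟨a / 4, by omega⟩
        apply e_eq_of_sub_eq_int (-k - 1)
        rw [hk]; push_cast; ring
      rw [h3, jacobiSym.one_left, h5]
      push_cast
      linear_combination e (-((49 * a : ℝ) * (A + 9) / 24)) * Complex.I_sq
  have f3 : (-1 : ℂ) ^ T * (-1) ^ ((A + 1) * ℓ : ℤ) = -(-1) ^ ℓ := by
    rw [← zpow_natCast, ← zpow_add₀ (by norm_num)]
    have h1 : T + (A + 1) * ℓ = 2 * (4 * T) + ε + ℓ := by linear_combination hT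
    rw [h1, zpow_add₀ (by norm_num), zpow_add₀ (by norm_num), (even_two_mul _).neg_one_zpow]
    rcases hε with rfl | rfl <;> norm_num
  push_cast at f1 f2 ⊢
  linear_combination (-(-1 : ℂ) ^ T * J((A : ℤ) | B) * e (-(49 * a * (A + 9) / 24)) *
      e (n * B / A)) * f1 + (-e (-((B + a) / (24 * A))) * J((A : ℤ) | B) *
      e (-(49 * a * (A + 9) / 24)) * e (n * B / A)) * f3 +
    ((-1 : ℂ) ^ ℓ * e (-((B + a) / (24 * A))) * J((A : ℤ) | B) * e (n * B / A)) * f2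

/-- The quadratic Gauss sum modulo `7`, as a polynomial in `e(1/7)`. -/
def gaussTerms : List (ℤ × ℤ) := [(1, 1), (1, 2), (-1, 3), (1, 4), (-1, 5), (-1, 6)]

theorem evalZt_gaussTerms : evalZt 7 gaussTerms = Complex.I * (Real.sqrt 7 : ℂ) := by
  have hsq : evalZt 7 (mulTerms gaussTerms gaussTerms ++ [(7, 0)]) = 0 :=
    evalZt_eq_zero (by norm_num) (by decide +kernel)
  rw [evalZt_append, evalZt_mulTerms] at hsq
  have h7 : evalZt 7 [(7, 0)] = 7 := by simp [evalZt, zt_zero]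
  rw [h7] at hsq
  have hs : (Real.sqrt 7 : ℂ) ^ 2 = 7 := by
    rw [← Complex.ofReal_pow, Real.sq_sqrt (by norm_num)]; norm_num
  have hfac : (evalZt 7 gaussTerms - Complex.I * (Real.sqrt 7 : ℂ)) *
      (evalZt 7 gaussTerms + Complex.I * (Real.sqrt 7 : ℂ)) = 0 := by
    linear_combination hsq - (Real.sqrt 7 : ℂ) ^ 2 * Complex.I_sq + hs
  rcases mul_eq_zero.1 hfac with h | h
  · exact sub_eq_zero.1 h
  exfalso
  -- The square being -7 leaves ±i√7; a positive imaginary part excludes the minus sign.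
  have him : ∀ k : ℤ, (zt 7 k).im = Real.sin (2 * Real.pi * k / 7) := by
    intro k
    rw [zt, e, Complex.exp_im]
    have e1 : (2 * (Real.pi : ℂ) * Complex.I * ((k / (7 : ℕ) : ℝ) : ℂ)) =
        ((2 * Real.pi * k / 7 : ℝ) : ℂ) * Complex.I := by push_cast; ring
    rw [e1]; simp
  have h1 := congrArg Complex.im h
  have hval : (evalZt 7 gaussTerms).im =
      2 * (Real.sin (2 * Real.pi / 7) + Real.sin (3 * Real.pi / 7) - Real.sin (Real.pi / 7)) := by
    simp only [evalZt, gaussTerms, List.map_cons, List.map_nil, List.sum_cons, List.sum_nil]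
    simp only [Int.cast_one, one_mul, Int.cast_neg, neg_mul, Complex.add_im, Complex.neg_im, him,
      Complex.zero_im]
    have s1 : Real.sin (2 * Real.pi * 1 / 7) = Real.sin (2 * Real.pi / 7) := by norm_num
    have s2 : Real.sin (2 * Real.pi * ((2 : ℤ) : ℝ) / 7) = Real.sin (3 * Real.pi / 7) := by
      rw [← Real.sin_pi_sub]; congr 1; push_cast; ring
    have s3 : Real.sin (2 * Real.pi * ((3 : ℤ) : ℝ) / 7) = Real.sin (Real.pi / 7) := by
      rw [← Real.sin_pi_sub]; congr 1; push_cast; ring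
    have s4 : Real.sin (2 * Real.pi * ((4 : ℤ) : ℝ) / 7) = -Real.sin (Real.pi / 7) := by
      rw [← Real.sin_add_pi]; congr 1; push_cast; ring
    have s5 : Real.sin (2 * Real.pi * ((5 : ℤ) : ℝ) / 7) = -Real.sin (3 * Real.pi / 7) := by
      rw [← Real.sin_add_pi]; congr 1; push_cast; ring
    have s6 : Real.sin (2 * Real.pi * ((6 : ℤ) : ℝ) / 7) = -Real.sin (2 * Real.pi / 7) := by
      rw [← Real.sin_neg, ← Real.sin_add_two_pi (-_)]; congr 1; push_cast; ring
    rw [s1, s2, s3, s4, s5, s6]; ring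
  have hpi := Real.pi_pos
  have hlt : Real.sin (Real.pi / 7) < Real.sin (2 * Real.pi / 7) := by
    apply Real.sin_lt_sin_of_lt_of_le_pi_div_two <;> linarith
  have hpos : 0 < Real.sin (3 * Real.pi / 7) := by
    apply Real.sin_pos_of_pos_of_lt_pi <;> linarith
  have hsqrt : 0 ≤ Real.sqrt 7 := Real.sqrt_nonneg 7
  simp only [Complex.add_im, Complex.mul_im, Complex.I_re, Complex.I_im, Complex.ofReal_re,
    Complex.ofReal_im, Complex.zero_im, hval] at h1
  linarith

/-! ### Whole sums when p ∤ A -/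

theorem exists_const_sum_infTerm {p A : ℕ} [NeZero A] [NeZero (p * A)] (hp : p.Prime) (hp5 : 5 ≤ p)
    (hpA : ¬ p ∣ A) (n : ℤ) {n₀ : ℕ} (hn : n ≡ n₀ [ZMOD p]) :
    ∃ (B : ZMod A → ℕ) (a : ZMod A → ℤ) (K : ZMod A → ℂ), (∀ r, ((B r : ℤ) : ZMod A) = r) ∧
      (∀ r, IsUnit r → a r * (p ^ 2 * B r) ≡ 1 [ZMOD (24 * A : ℕ)]) ∧
      (∀ r, IsUnit r → K r = classConst p A (B r) (a r) n) ∧ (∀ r, ¬ IsUnit r → K r = 0) ∧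
      ∀ ℓ, ¬ p ∣ ℓ → sinPi p ℓ * ∑ z, infTerm p ℓ n (p * A) z =
        (∑ r, K r) * evalZt p (classTerms p ℓ n₀ (A % p)) := by
  classical
  have hA : 0 < A := Nat.pos_of_ne_zero (NeZero.ne A)
  have hp24 := coprime_twentyFour hp hp5
  have hpA' : p.Coprime A := (Nat.Prime.coprime_iff_not_dvd hp).2 hpA
  have h1 : ∀ r : ZMod A, ∃ B : ℕ, (B : ZMod A) = r ∧ (IsUnit r → B.Coprime (24 * A)) := by
    intro r
    by_cases hr : IsUnit r
    · obtain ⟨B, hB, hBr⟩ := exists_coprime_lift (M := 24 * A) (by omega) (Dvd.intro_left _ rfl) hr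
      exact ⟨B, hBr, fun _ => hB⟩
    · exact ⟨r.val, by simp, fun h => absurd h hr⟩
  choose B hB hBc using h1
  have h2 : ∀ r : ZMod A, ∃ a : ℤ, IsUnit r → a * (p ^ 2 * B r) ≡ 1 [ZMOD (24 * A : ℕ)] := by
    intro r
    by_cases hr : IsUnit r
    · have : (p ^ 2 * B r).Coprime (24 * A) :=
        Nat.Coprime.mul_left (Nat.Coprime.pow_left 2 (hp24.mul_right hpA')) (hBc r hr)
      obtain ⟨a, ha⟩ := exists_int_inverse this
      exact ⟨a, fun _ => by exact_mod_cast ha⟩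
    · exact ⟨0, fun h => absurd h hr⟩
  choose a ha using h2
  refine ⟨B, a, fun r => if IsUnit r then classConst p A (B r) (a r) n else 0, ?_, ha, ?_, ?_, ?_⟩
  · intro r; simpa using hB r
  · intro r hr; simp [hr]
  · intro r hr; simp [hr]
  · intro ℓ hℓ
    -- p is invertible mod A, so the representatives pB still meet every class once.
    have hpu : IsUnit ((p : ℕ) : ZMod A) := (ZMod.isUnit_iff_coprime _ _).2 hpA'
    rw [sum_zmod_eq_sum_fibre hp hp5 _ (fun r => p * B r), mul_sum, sum_mul]
    · refine sum_congr rfl fun r _ => ?_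
      by_cases hr : IsUnit r
      · rw [if_pos hr]
        exact sum_infTerm_progression hp hp5 hA hpA (ha r hr) hℓ n n₀ hn
      · rw [if_neg hr, zero_mul, sum_eq_zero, mul_zero]
        intro t _
        apply infTerm_of_not_isUnit
        intro hu
        apply hr
        have := hu.map (ZMod.castHom (Dvd.intro_left p rfl : A ∣ p * A) (ZMod A))
        rw [map_intCast] at this
        push_cast at this
        rw [hB] at this
        simp only [ZMod.natCast_self, mul_zero, zero_mul, add_zero] at this
        exact isUnit_of_mul_isUnit_right this
    · intro r r' h
      simp only [Int.cast_mul, Int.cast_natCast, hB] at h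
      exact hpu.mul_left_cancel h

/-- The Laurent polynomial of the class sums of `S7` when `7 ∤ A`. -/
def classTermsSeven (ℓ n A : ℕ) : List (ℤ × ℤ) :=
  classTerms 7 ℓ n A ++
    if A * ℓ % 7 = 1 then mulTerms gaussTerms [(1, 4 * ℓ), (-1, -(4 * ℓ))]
    else if A * ℓ % 7 = 6 then mulTerms gaussTerms [(-1, 4 * ℓ), (1, -(4 * ℓ))] else []

/-- Treats both cases at once through Aℓ = 7T + ε: for ε = -1, expanding in T - 1 gives K = (3T² -
T)/2, and Aℓ - 6 = 7(T - 1) yields the extra sign ε. -/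
theorem SZeroInf_eq {A ℓ : ℕ} (n : ℤ) {ε : ℤ}
    (h : ε = 1 ∧ A * ℓ % 7 = 1 ∨ ε = -1 ∧ A * ℓ % 7 = 6) :
    ∃ T K : ℤ, (A * ℓ : ℤ) = 7 * T + ε ∧ 2 * K = 3 * T ^ 2 + ε * T ∧
      SZeroInf ℓ n A = ε * ((-1) ^ T * SZeroInfSum K n A) := by
  have heven : ∀ T : ℤ, ∀ ε : ℤ, ε = 1 ∨ ε = -1 → ∃ K, 2 * K = 3 * T ^ 2 + ε * T := by
    rintro T ε (rfl | rfl)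
    · obtain ⟨k, hk⟩ := Int.even_mul_succ_self T
      exact ⟨T ^ 2 + k, by linear_combination -hk⟩
    · obtain ⟨k, hk⟩ := Int.even_mul_pred_self T
      exact ⟨T ^ 2 + k, by linear_combination -hk⟩
  rcases h with ⟨rfl, h⟩ | ⟨rfl, h⟩
  · obtain ⟨K, hK⟩ := heven ((A * ℓ / 7 : ℕ) : ℤ) 1 (Or.inl rfl)
    have hKr : (2 : ℝ) * K = 3 * ((A * ℓ / 7 : ℕ) : ℝ) ^ 2 + ((A * ℓ / 7 : ℕ) : ℝ) := by
      have := congrArg (fun z : ℤ => (z : ℝ)) hK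
      simpa only [Int.cast_mul, Int.cast_add, Int.cast_pow, Int.cast_natCast, Int.cast_ofNat,
        Int.cast_one, one_mul] using this
    refine ⟨((A * ℓ / 7 : ℕ) : ℤ), K, ?_, hK, ?_⟩
    · have := Nat.div_add_mod (A * ℓ) 7
      rw [h] at this
      exact_mod_cast this.symm
    · rw [SZeroInf, if_pos h, h, zpow_natCast]
      have e1 : A * ℓ - 1 = 7 * (A * ℓ / 7) := by omega
      rw [e1, pow_mul]
      have e2 : (3 / 2 * ((A * ℓ / 7 : ℕ) : ℝ) ^ 2 + 1 / 2 * ((A * ℓ / 7 : ℕ) : ℝ)) = K := by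
        linarith
      simp only [e2]
      norm_num
  · set T := (A * ℓ + 1) / 7 with hT
    obtain ⟨K, hK⟩ := heven (T : ℤ) (-1) (Or.inr rfl)
    have hKr : (2 : ℝ) * K = 3 * (T : ℝ) ^ 2 - T := by
      have := congrArg (fun z : ℤ => (z : ℝ)) hK
      push_cast at this
      linarith
    refine ⟨T, K, ?_, hK, ?_⟩
    · have : A * ℓ + 1 = 7 * T := by omega
      have : (A * ℓ + 1 : ℤ) = 7 * T := by exact_mod_cast this
      linarith
    · rw [SZeroInf, if_neg (by omega), if_pos h, h, zpow_natCast, ← hT]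
      obtain ⟨m, hm⟩ : ∃ m, T = m + 1 := ⟨T - 1, by omega⟩
      have e1 : A * ℓ - 6 = 7 * m := by omega
      have e2 : (3 / 2 * ((T : ℝ) - 1) ^ 2 + 5 / 2 * ((T : ℝ) - 1) + 1) = K := by
        linarith
      simp only [e2]
      rw [e1, hm, pow_mul, pow_succ]
      norm_num
      ring

theorem exists_const_S7 {A : ℕ} (hA : 0 < A) (hA7 : ¬ 7 ∣ A) (n : ℤ) {n₀ : ℕ}
    (hn : n ≡ n₀ [ZMOD (7 : ℕ)]) :
    ∃ K : ℂ, ∀ ℓ, ¬ 7 ∣ ℓ → S7 ℓ n (7 * A) = K * evalZt 7 (classTermsSeven ℓ n₀ (A % 7)) := by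
  classical
  have : NeZero A := ⟨hA.ne'⟩
  have : NeZero (7 * A) := ⟨by omega⟩
  obtain ⟨B, a, K, hB, ha, hK1, hK0, hsum⟩ :=
    exists_const_sum_infTerm (p := 7) (by norm_num) (by norm_num) hA7 n hn
  -- The factor -i is e(-1/8)²: one factor belongs to `S7`, the other to `SInfInf`.
  refine ⟨-Complex.I * ∑ r, K r, fun ℓ hℓ => ?_⟩
  have h1 := hsum ℓ hℓ
  have h8 : e (-(1 / 8)) * e (-(1 / 8)) = -Complex.I := by
    rw [← e_add, ← e_neg_quarter]; norm_num
  have hS := sinPi_eq_zt (p := 7) (by norm_num) ℓ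
  have hzero : ∀ ε : ℤ, (ε = 1 ∧ A * ℓ % 7 = 1 ∨ ε = -1 ∧ A * ℓ % 7 = 6) →
      (Real.sqrt 7 : ℂ) * SZeroInf ℓ n A =
        ε * ((-1) ^ ℓ * ((∑ r, K r) * evalZt 7 gaussTerms)) := by
    intro ε hε
    obtain ⟨T, k, hT, hk, hSz⟩ := SZeroInf_eq n hε
    rw [hSz, SZeroInfSum_eq_sum hA7 k n (fun r => (B r : ℤ)) (fun r => 49 * a r) hB]
    · have hterm : ∀ r, (-1 : ℂ) ^ T * (if IsUnit r then
          e (-(k * ((49 * a r : ℤ) : ℝ) / A)) * dedekindRoot (B r : ℤ) A *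
            e (n * ((B r : ℤ) : ℝ) / A) else 0) = (-1) ^ ℓ * Complex.I * K r := by
        intro r
        by_cases hr : IsUnit r
        · rw [if_pos hr, hK1 r hr]
          exact zeroTerm_eq hA (ha r hr) n (by tauto) hT hk
        · rw [if_neg hr, hK0 r hr]; simp
      rw [mul_sum, sum_congr rfl fun r _ => hterm r, ← mul_sum, evalZt_gaussTerms]
      ring
    · intro r hr
      have := (ha r hr).of_dvd (Int.natCast_dvd_natCast.2 (Dvd.intro_left 24 rfl : A ∣ 24 * A))
      convert this using 1
      push_cast; ring
  rw [S7, SInfInf_eq_sum, Nat.mul_div_cancel_left A (by norm_num), classTermsSeven, evalZt_append,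
    Nat.mod_mul_mod]
  have hq : ∀ x : ℤ, evalZt 7 [(x, 4 * (ℓ : ℤ)), (-x, -(4 * ℓ))] =
      x * (zt 7 (4 * ℓ) - zt 7 (-(4 * ℓ))) := by
    intro x; simp [evalZt]; ring
  have hS' : sinPi 7 ℓ * (2 * (-1) ^ ℓ) = -Complex.I * (zt 7 (4 * ℓ) - zt 7 (-(4 * ℓ))) := by
    rw [hS, mul_div_assoc, show (7 + 1) / 2 * ℓ = 4 * ℓ by norm_num, div_eq_mul_inv, mul_inv,
      Complex.inv_I]
    push_cast
    linear_combination (-Complex.I * (zt 7 (4 * ℓ) - zt 7 (-(4 * ℓ)))) * neg_one_pow_mul_self ℓ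
  have main : sinPi 7 ℓ * (e (-(1 / 8)) * (e (-(1 / 8)) * ∑ z, infTerm 7 ℓ n (7 * A) z)) =
      -Complex.I * (∑ r, K r) * evalZt 7 (classTerms 7 ℓ n₀ (A % 7)) := by
    linear_combination h8 * sinPi 7 ℓ * (∑ z, infTerm 7 ℓ n (7 * A) z) - Complex.I * h1
  by_cases h : A * ℓ % 7 = 1
  · rw [if_pos (Or.inl h), if_pos h, evalZt_mulTerms, hq, mul_add, main]
    linear_combination 2 * sinPi 7 ℓ * hzero 1 (Or.inl ⟨rfl, h⟩) +
      (∑ r, K r) * evalZt 7 gaussTerms * hS'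
  · rw [if_neg h]
    by_cases h6 : A * ℓ % 7 = 6
    · have hq' := hq (-1)
      rw [neg_neg] at hq'
      rw [if_pos (Or.inr h6), if_pos h6, evalZt_mulTerms, hq', mul_add, main]
      linear_combination 2 * sinPi 7 ℓ * hzero (-1) (Or.inr ⟨rfl, h6⟩) -
        (∑ r, K r) * evalZt 7 gaussTerms * hS'
    · rw [if_neg (by tauto), if_neg h6, mul_add, main]
      simp [evalZt]

/-! ### Residue classes modulo A when p ∣ A -/

theorem infTerm_progression_of_dvd {p A B : ℕ} (hp : p.Prime) (hp5 : 5 ≤ p) (hA : 0 < A)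
    (hpA : p ∣ A) {a : ℤ} (ha : a * B ≡ 1 [ZMOD (24 * (p * A) : ℕ)]) (ℓ t : ℕ) (n : ℤ) :
    infTerm p ℓ n (p * A) ((B + 24 * A * t : ℤ) : ZMod (p * A)) =
      sinKernel p ℓ (p * A) a * (dedekindRoot B (p * A) * e (n * B / (p * A : ℕ)) *
        zt p ((24 * n - 1 + a ^ 2) * t)) := by
  have hp0 : 0 < p := hp.pos
  have hp2 : p % 2 = 1 := (Nat.odd_iff.1 (hp.odd_of_ne_two (by omega)))
  obtain ⟨A', rfl⟩ := hpA
  obtain ⟨k, hk⟩ := ha.dvd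
  push_cast at hk
  set d := B + 24 * (p * A') * t with hd
  -- The first-order inverse of B + 24(pA')t; it is exact modulo 24p(pA') because p divides the
  -- modulus pA' of the class.
  set α := a - 24 * a ^ 2 * t * (p * A' : ℕ) with hα
  have hdz : ((B + 24 * (p * A' : ℕ) * t : ℤ)) = (d : ℤ) := by rw [hd]; push_cast; ring
  have hmod : α * d ≡ 1 [ZMOD (24 * (p * (p * A')) : ℕ)] := by
    refine Int.modEq_iff_dvd.2 ⟨k - t * a * 24 * p * A' * k + 24 * a ^ 2 * t ^ 2 * A', ?_⟩
    rw [← hdz, hα]; push_cast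
    linear_combination (1 - t * a * 24 * p * A') * hk
  have hα2 : α % 2 = 1 := (odd_of_mul_modEq_one hmod).1
  have ha2 : a % 2 = 1 := (odd_of_mul_modEq_one ha).1
  have hB2 : B % 2 = 1 := by have := (odd_of_mul_modEq_one ha).2; omega
  have hd2 : d % 2 = 1 := by have := (odd_of_mul_modEq_one hmod).2; omega
  have hmod' : α * d ≡ 1 [ZMOD (p * (p * A') : ℕ)] :=
    hmod.of_dvd (Int.natCast_dvd_natCast.2 (Dvd.intro_left 24 rfl))
  -- The modulus contains p², which drops out of the Jacobi symbol; the rest depends on d only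
  -- modulo 4A'.
  have hJ : ∀ b : ℕ, b.Coprime (24 * (p * (p * A'))) →
      J(((p * (p * A') : ℕ) : ℤ) | b) = J((A' : ℤ) | b) := by
    intro b hb
    have h1 : p.Coprime b := (hb.coprime_dvd_right ⟨24 * (p * A'), by ring⟩).symm
    have h2 : J((p : ℤ) | b) ^ 2 = 1 := jacobiSym.sq_one (by simpa using h1)
    rw [Nat.cast_mul, Nat.cast_mul, jacobiSym.mul_left, jacobiSym.mul_left]
    linear_combination J((A' : ℤ) | b) * h2
  have hJ2 : J((A' : ℤ) | d) = J((A' : ℤ) | B) := by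
    rw [jacobiSym.mod_right' A' (Nat.odd_iff.2 hd2), jacobiSym.mod_right' A' (Nat.odd_iff.2 hB2)]
    congr 1
    have : d = B + 4 * A' * (6 * p * t) := by rw [hd]; ring
    rw [this, Nat.add_mul_mod_self_left]
  rw [hdz, infTerm_intCast hp0 ℓ n hA hmod',
    dedekindRoot_eq (Nat.mul_pos hp0 hA) (coprime_of_mul_modEq_one hmod) hmod,
    dedekindRoot_eq (Nat.mul_pos hp0 hA) (coprime_of_mul_modEq_one ha) ha,
    sinKernel_eq_zt hp2 ℓ _ hα2, sinKernel_eq_zt hp2 ℓ _ ha2, hJ _ (coprime_of_mul_modEq_one hmod),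
    hJ _ (coprime_of_mul_modEq_one ha), hJ2]
  obtain ⟨h, hh⟩ : ∃ h, (p + 1) / 2 = h := ⟨_, rfl⟩
  rw [hh]
  have hp0' : (p : ℝ) ≠ 0 := by positivity
  have hA0' : (A' : ℝ) ≠ 0 := by
    have : A' ≠ 0 := by rintro rfl; simp at hA
    exact_mod_cast this
  have hdr : (d : ℝ) = B + 24 * (p * A') * t := by rw [hd]; push_cast; ring
  have hαr : (α : ℝ) = a - 24 * a ^ 2 * t * (p * A') := by rw [hα]; push_cast; ring
  have hαp : α ≡ a [ZMOD p] :=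
    Int.modEq_iff_dvd.2 ⟨24 * a ^ 2 * t * A', by rw [hα]; push_cast; ring⟩
  have z1 : zt p (h * (α * ℓ)) = zt p (h * (a * ℓ)) :=
    zt_congr hp0 ((hαp.mul_right _).mul_left _)
  have z2 : zt p (-(h * (α * ℓ))) = zt p (-(h * (a * ℓ))) :=
    zt_congr hp0 ((hαp.mul_right _).mul_left _).neg
  have z3 : zt p (-(3 * h * (p * A' : ℕ) * ℓ ^ 2 * α)) =
      zt p (-(3 * h * (p * A' : ℕ) * ℓ ^ 2 * a)) :=
    zt_congr hp0 (hαp.mul_left _).neg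
  have z4 : e (-(((d : ℤ) + α) / (24 * ((p * (p * A') : ℕ) : ℝ)))) =
      e (-(((B : ℤ) + a) / (24 * ((p * (p * A') : ℕ) : ℝ)))) * zt p ((-1 + a ^ 2) * t) := by
    rw [zt, ← e_add]; congr 1
    push_cast
    rw [hdr, hαr]
    field_simp
    ring
  have z5 : e (-(α * (((p * (p * A') : ℕ) : ℝ) + 9) / 24)) =
      e (-(a * (((p * (p * A') : ℕ) : ℝ) + 9) / 24)) := by
    apply e_eq_of_sub_eq_int (a ^ 2 * t * (p * A') * (p * (p * A') + 9))
    push_cast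
    rw [hαr]; ring
  have z6 : e (n * (d : ℤ) / (p * (p * A') : ℕ)) =
      e (n * (B : ℤ) / (p * (p * A') : ℕ)) * zt p (24 * n * t) := by
    rw [zt, ← e_add]; congr 1
    push_cast
    rw [hdr]
    field_simp
  have z7 : zt p ((24 * n - 1 + a ^ 2) * t) = zt p (24 * n * t) * zt p ((-1 + a ^ 2) * t) := by
    rw [← zt_add]; congr 1; ring
  push_cast at z3 z4 z5 z6 ⊢
  rw [z1, z2, z3, z4, z5, z6, z7]
  ring

theorem sinPi_mul_sinKernel {p A : ℕ} (hp : p.Prime) (hp5 : 5 ≤ p) (hpA : p ∣ A) {a : ℤ}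
    (ha2 : a % 2 = 1) {y : ℕ} (hay : a ≡ y [ZMOD p]) (hy : ¬ p ∣ y) {ℓ : ℕ} (hℓ : ¬ p ∣ ℓ) :
    sinPi p ℓ * sinKernel p ℓ (p * A) a =
      evalZt p (sinRatio ((p + 1) / 2 * ℓ) y (y ^ (p - 2) % p)) := by
  have hp2 : p % 2 = 1 := (Nat.odd_iff.1 (hp.odd_of_ne_two (by omega)))
  have hq : ¬ p ∣ (p + 1) / 2 * ℓ := by
    intro h
    rcases (Nat.Prime.dvd_mul hp).1 h with h | h
    · have := Nat.le_of_dvd (by omega) h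
      omega
    · exact hℓ h
  rw [evalZt_sinRatio hp (by omega) hq (mul_pow_sub_two hp hy) hay, sinPi_eq_zt hp2,
    sinKernel_eq_zt hp2 ℓ A ha2]
  have z1 : zt p (-(3 * ((p + 1) / 2 : ℕ) * A * ℓ ^ 2 * a)) = 1 := by
    rw [← zt_zero p]
    obtain ⟨k, hk⟩ := hpA
    apply zt_congr hp.pos
    refine Int.modEq_iff_dvd.2 ⟨3 * ((p + 1) / 2 : ℕ) * k * ℓ ^ 2 * a, ?_⟩
    rw [hk]; push_cast; ring
  have e1 : (((p + 1) / 2 : ℕ) : ℤ) * (a * ℓ) = (((p + 1) / 2 * ℓ : ℕ) : ℤ) * a := by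
    push_cast; ring
  rw [z1, e1]
  have hI : (2 * Complex.I) * (2 * Complex.I)⁻¹ = 1 := mul_inv_cancel₀ (by simp)
  rw [div_eq_mul_inv, div_eq_mul_inv, div_eq_mul_inv]
  set X := zt p ((((p + 1) / 2 * ℓ : ℕ) : ℤ)) - zt p (-(((p + 1) / 2 * ℓ : ℕ) : ℤ))
  set D := zt p ((((p + 1) / 2 * ℓ : ℕ) : ℤ) * a) - zt p (-((((p + 1) / 2 * ℓ : ℕ) : ℤ) * a))
  linear_combination (X * D⁻¹ * (2 * Complex.I * (2 * Complex.I)⁻¹)) * neg_one_pow_mul_self ℓ +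
    (X * D⁻¹) * hI

/-- The weight W contains the geometric sum over t, hence vanishes unless y² ≡ 1 - 24n mod p. It
does not involve ℓ, so one set of weights serves every term of a linear relation. -/
theorem exists_weights_of_dvd {p A : ℕ} [NeZero A] [NeZero (p * A)] (hp : p.Prime) (hp5 : 5 ≤ p)
    (hpA : p ∣ A) (n : ℤ) :
    ∃ (W : ZMod A → ℂ) (y : ZMod A → ℕ),
      (∀ r, W r = 0 ∨ (y r ∈ Ico 1 p ∧ (p : ℤ) ∣ 24 * n - 1 + (y r : ℤ) ^ 2)) ∧
      ∀ ℓ, ¬ p ∣ ℓ → sinPi p ℓ * ∑ z, infTerm p ℓ n (p * A) z =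
        ∑ r, W r * evalZt p (sinRatio ((p + 1) / 2 * ℓ) (y r) (y r ^ (p - 2) % p)) := by
  classical
  have hA : 0 < A := Nat.pos_of_ne_zero (NeZero.ne A)
  have hpA0 : 0 < p * A := Nat.mul_pos hp.pos hA
  have h1 : ∀ r : ZMod A, ∃ B : ℕ, ∃ a : ℤ, (B : ZMod A) = r ∧
      (IsUnit r → a * B ≡ 1 [ZMOD (24 * (p * A) : ℕ)]) := by
    intro r
    by_cases hr : IsUnit r
    · obtain ⟨B, hB, hBr⟩ := exists_coprime_lift (M := 24 * (p * A)) (by omega)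
        ⟨24 * p, by ring⟩ hr
      obtain ⟨a, ha⟩ := exists_int_inverse hB
      exact ⟨B, a, hBr, fun _ => ha⟩
    · exact ⟨r.val, 0, by simp, fun h => absurd h hr⟩
  choose B a hB ha using h1
  have hp0 : (p : ℤ) ≠ 0 := by exact_mod_cast hp.ne_zero
  have hy : ∀ r, (((a r % p).toNat : ℕ) : ℤ) = a r % p := fun r =>
    Int.toNat_of_nonneg (Int.emod_nonneg _ hp0)
  have hay : ∀ r, a r ≡ ((a r % p).toNat : ℕ) [ZMOD p] := by
    intro r; rw [hy]; exact (Int.mod_modEq _ _).symm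
  have hyp : ∀ r, IsUnit r → ¬ p ∣ (a r % p).toNat := by
    intro r hr h
    have h2 : (p : ℤ) ∣ a r := (hay r).dvd_iff.2 (by exact_mod_cast h)
    have h3 : a r * B r ≡ 1 [ZMOD p] :=
      (ha r hr).of_dvd (Int.natCast_dvd_natCast.2 ⟨24 * A, by ring⟩)
    have h4 := h3.dvd_iff.1 (Dvd.dvd.mul_right h2 _)
    have := Int.le_of_dvd one_pos h4
    have := hp.one_lt
    omega
  refine ⟨fun r => if IsUnit r then dedekindRoot (B r) (p * A) * e (n * B r / (p * A : ℕ)) *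
      ∑ t ∈ range p, zt p ((24 * n - 1 + a r ^ 2) * t) else 0,
    fun r => (a r % p).toNat, ?_, ?_⟩
  · intro r
    by_cases hr : IsUnit r
    swap
    · left; simp [hr]
    by_cases hd : (p : ℤ) ∣ 24 * n - 1 + a r ^ 2
    · right
      refine ⟨?_, ?_⟩
      · rw [mem_Ico]
        refine ⟨Nat.one_le_iff_ne_zero.2 fun h0 =>
          hyp r hr (Dvd.intro_left 0 (by simpa using h0.symm)), ?_⟩
        have := Int.emod_lt_of_pos (a r) (by exact_mod_cast hp.pos : (0 : ℤ) < p)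
        rw [← hy] at this
        exact_mod_cast this
      · exact (((hay r).pow 2).add_left (24 * n - 1)).dvd_iff.1 hd
    · left
      simp [sum_zt_eq_zero hp.pos hd]
  · intro ℓ hℓ
    rw [sum_zmod_eq_sum_fibre hp hp5 _ (fun r => (B r : ℤ)), mul_sum]
    · refine sum_congr rfl fun r _ => ?_
      dsimp only
      by_cases hr : IsUnit r
      · rw [if_pos hr, sum_congr rfl fun t _ =>
          infTerm_progression_of_dvd hp hp5 hA hpA (ha r hr) ℓ t n, ← mul_sum, ← mul_sum,
          ← sinPi_mul_sinKernel hp hp5 hpA _ (hay r) (hyp r hr) hℓ]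
        · ring
        · exact (odd_of_mul_modEq_one (ha r hr)).1
      · rw [if_neg hr, zero_mul, sum_eq_zero, mul_zero]
        intro t _
        apply infTerm_of_not_isUnit
        intro hu
        apply hr
        have := hu.map (ZMod.castHom (Dvd.intro_left p rfl : A ∣ p * A) (ZMod A))
        rw [map_intCast] at this
        push_cast at this
        rw [hB] at this
        simpa only [ZMod.natCast_self, mul_zero, zero_mul, add_zero] using this
    · intro r r' h
      simpa only [Int.cast_natCast, hB] using h

/-! ### Reduction to a finite check -/

/-- The finitely many polynomial identities behind the vanishing of a linear combination of class
sums, for `n ≡ r`: here `cs` lists pairs (coefficient, `ℓ`), and `F ℓ A` is the Laurent polynomial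
of the class sum at `ℓ` for `A` prime to `p`. -/
def identityCheck (p r : ℕ) (F : ℕ → ℕ → List (ℤ × ℤ)) (cs : List (List (ℤ × ℤ) × ℕ)) : Bool :=
  (cs.all fun c => c.2 % p != 0) &&
  ((List.range p).all fun A => A == 0 ||
    isConstMod p (cs.flatMap fun c => mulTerms c.1 (F c.2 A))) &&
  ((List.range p).all fun y => y == 0 || (24 * r + (p - 1) + y ^ 2) % p != 0 ||
    isConstMod p (cs.flatMap fun c =>
      mulTerms c.1 (sinRatio ((p + 1) / 2 * c.2) y (y ^ (p - 2) % p))))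

theorem sum_eq_zero_of_identityCheck {p r : ℕ} {F : ℕ → ℕ → List (ℤ × ℤ)}
    {cs : List (List (ℤ × ℤ) × ℕ)} (h : identityCheck p r F cs = true) (hp : p.Prime) {A : ℕ}
    [NeZero A] {n : ℤ} (hn : n ≡ r [ZMOD p]) (X : ℕ → ℂ)
    (hX : ¬ p ∣ A → ∃ K, ∀ ℓ, ¬ p ∣ ℓ → X ℓ = K * evalZt p (F ℓ (A % p)))
    (hX' : p ∣ A → ∃ (W : ZMod A → ℂ) (y : ZMod A → ℕ),
      (∀ r, W r = 0 ∨ (y r ∈ Ico 1 p ∧ (p : ℤ) ∣ 24 * n - 1 + (y r : ℤ) ^ 2)) ∧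
      ∀ ℓ, ¬ p ∣ ℓ → X ℓ =
        ∑ r : ZMod A,
          W r * evalZt p (sinRatio ((p + 1) / 2 * ℓ) (y r) (y r ^ (p - 2) % p))) :
    (cs.map fun c => evalZt p c.1 * X c.2).sum = 0 := by
  simp only [identityCheck, Bool.and_eq_true, List.all_eq_true, List.mem_range, bne_iff_ne,
    Bool.or_eq_true, beq_iff_eq] at h
  obtain ⟨⟨h1, h2⟩, h3⟩ := h
  have h1' : ∀ c ∈ cs, ¬ p ∣ c.2 := fun c hc hd => h1 c hc (Nat.mod_eq_zero_of_dvd hd)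
  by_cases hpA : p ∣ A
  · obtain ⟨W, y, hW, hXW⟩ := hX' hpA
    have e1 : (cs.map fun c => evalZt p c.1 * X c.2).sum =
        ∑ r : ZMod A, W r *
          evalZt p (cs.flatMap fun c =>
            mulTerms c.1 (sinRatio ((p + 1) / 2 * c.2) (y r) (y r ^ (p - 2) % p))) := by
      simp only [evalZt_flatMap, evalZt_mulTerms]
      have : ∀ c ∈ cs, evalZt p c.1 * X c.2 =
          ∑ r : ZMod A, W r * (evalZt p c.1 *
            evalZt p (sinRatio ((p + 1) / 2 * c.2) (y r) (y r ^ (p - 2) % p))) := by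
        intro c hc
        rw [hXW c.2 (h1' c hc), mul_sum]
        exact sum_congr rfl fun r _ => by ring
      rw [List.map_congr_left this]
      clear this h1 h2 h3 h1'
      induction cs with
      | nil => simp
      | cons c cs ih =>
        simp only [List.map_cons, List.sum_cons, mul_add, sum_add_distrib]
        rw [ih]
    rw [e1]
    refine sum_eq_zero fun z _ => ?_
    rcases hW z with h0 | ⟨hy, hd⟩
    · rw [h0, zero_mul]
    · rw [mem_Ico] at hy
      rcases h3 (y z) hy.2 with (h | h) | h
      · omega
      · exfalso
        apply h
        apply Nat.mod_eq_zero_of_dvd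
        have e2 : (24 * n - 1 + (y z : ℤ) ^ 2) ≡ (24 * r - 1 + (y z : ℤ) ^ 2) [ZMOD p] := by
          gcongr
        have e3 := e2.dvd_iff.1 hd
        -- The check is made in ℕ, where p - 1 stands for -1.
        have e4 : ((24 * r + (p - 1) + y z ^ 2 : ℕ) : ℤ) = (24 * r - 1 + (y z : ℤ) ^ 2) + p := by
          have := hp.one_lt
          push_cast [Nat.cast_sub this.le]
          ring
        rw [← Int.natCast_dvd_natCast, e4]
        exact dvd_add e3 (dvd_refl _)
      · rw [evalZt_eq_zero hp.one_lt h, mul_zero]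
  · obtain ⟨K, hK⟩ := hX hpA
    have e1 : (cs.map fun c => evalZt p c.1 * X c.2).sum =
        K * evalZt p (cs.flatMap fun c => mulTerms c.1 (F c.2 (A % p))) := by
      rw [evalZt_flatMap, ← List.sum_map_mul_left]
      congr 1
      refine List.map_congr_left fun c hc => ?_
      rw [hK c.2 (h1' c hc), evalZt_mulTerms]
      ring
    rw [e1]
    rcases h2 (A % p) (Nat.mod_lt _ hp.pos) with h | h
    · exact absurd (Nat.dvd_of_mod_eq_zero h) hpA
    · rw [evalZt_eq_zero hp.one_lt h, mul_zero]

theorem sum_S7_eq_zero {r : ℕ} {cs : List (List (ℤ × ℤ) × ℕ)}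
    (h : identityCheck 7 r (fun ℓ A => classTermsSeven ℓ r A) cs = true) {n : ℤ}
    (hn : n ≡ r [ZMOD (7 : ℕ)]) {c : ℕ} (hc : 0 < c) (h7 : 7 ∣ c) :
    (cs.map fun x => evalZt 7 x.1 * S7 x.2 n c).sum = 0 := by
  obtain ⟨A, rfl⟩ := h7
  have hA : 0 < A := by omega
  have : NeZero A := ⟨hA.ne'⟩
  have : NeZero (7 * A) := ⟨hc.ne'⟩
  refine sum_eq_zero_of_identityCheck h (by norm_num) (A := A) hn (fun ℓ => S7 ℓ n (7 * A))
    (fun h7 => exists_const_S7 hA h7 n hn) fun h7 => ?_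
  obtain ⟨W, y, hW, hs⟩ := exists_weights_of_dvd (p := 7) (by norm_num) (by norm_num) h7 n
  refine ⟨fun r => e (-(1 / 8)) ^ 2 * W r, y, fun r => ?_, fun ℓ hℓ => ?_⟩
  · rcases hW r with h | h
    · left; simp [h]
    · exact Or.inr h
  · have h0 : A * ℓ % 7 = 0 := Nat.mod_eq_zero_of_dvd (Dvd.dvd.mul_right h7 _)
    rw [S7, SInfInf_eq_sum, Nat.mul_div_cancel_left A (by norm_num), if_neg (by omega)]
    simp only [mul_assoc]
    rw [← mul_sum, ← hs ℓ hℓ]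
    ring

theorem sum_SInfInf_five_eq_zero {r : ℕ} {cs : List (List (ℤ × ℤ) × ℕ)}
    (h : identityCheck 5 r (fun ℓ A => classTerms 5 ℓ r A) cs = true) {n : ℤ}
    (hn : n ≡ r [ZMOD (5 : ℕ)]) {c : ℕ} (hc : 0 < c) (h5 : 5 ∣ c) :
    (cs.map fun x => evalZt 5 x.1 * (sinPi 5 x.2 * SInfInf 5 x.2 n c)).sum = 0 := by
  obtain ⟨A, rfl⟩ := h5
  have hA : 0 < A := by omega
  have : NeZero A := ⟨hA.ne'⟩
  have : NeZero (5 * A) := ⟨hc.ne'⟩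
  refine sum_eq_zero_of_identityCheck h (by norm_num) (A := A) hn
    (fun ℓ => sinPi 5 ℓ * SInfInf 5 ℓ n (5 * A)) (fun h5 => ?_) fun h5 => ?_
  · obtain ⟨_, _, K, -, -, -, -, hs⟩ :=
      exists_const_sum_infTerm (p := 5) (by norm_num) (by norm_num) h5 n hn
    refine ⟨e (-(1 / 8)) * ∑ r, K r, fun ℓ hℓ => ?_⟩
    rw [SInfInf_eq_sum]
    linear_combination e (-(1 / 8)) * hs ℓ hℓ
  · obtain ⟨W, y, hW, hs⟩ := exists_weights_of_dvd (p := 5) (by norm_num) (by norm_num) h5 n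
    refine ⟨fun r => e (-(1 / 8)) * W r, y, fun r => ?_, fun ℓ hℓ => ?_⟩
    · rcases hW r with h | h
      · left; simp [h]
      · exact Or.inr h
    · rw [SInfInf_eq_sum]
      simp only [mul_assoc]
      rw [← mul_sum, ← hs ℓ hℓ]
      ring

/-! ### The individual relations -/

/-- The Laurent polynomial of `2 cos(2πi/p) - 2 cos(2πj/p)`. -/
def cosTerms (i j : ℤ) : List (ℤ × ℤ) := [(1, i), (1, -i), (-1, j), (-1, -j)]

theorem zt_add_zt_neg (p : ℕ) (i : ℕ) :
    zt p i + zt p (-i) = 2 * (Real.cos (((2 * i : ℕ) : ℝ) * Real.pi / p) : ℂ) := by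
  rw [Complex.ofReal_cos, Complex.two_cos, zt, zt, e, e]
  congr 2 <;> push_cast <;> ring

theorem evalZt_cosTerms (p i j : ℕ) :
    evalZt p (cosTerms i j) = 2 * cosDiff p (2 * i) (2 * j) := by
  rw [cosDiff, Complex.ofReal_sub, mul_sub, ← zt_add_zt_neg, ← zt_add_zt_neg]
  simp [evalZt, cosTerms]
  ring

theorem sinPi_ne_zero {p ℓ : ℕ} (h0 : 0 < ℓ) (h : ℓ < p) : sinPi p ℓ ≠ 0 := by
  have hp : (0 : ℝ) < p := by exact_mod_cast h0.trans h
  have h1 : Real.pi * ℓ / p < Real.pi := by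
    rw [div_lt_iff₀ hp]
    exact mul_lt_mul_of_pos_left (by exact_mod_cast h) Real.pi_pos
  have h2 : 0 < Real.pi * ℓ / p := by
    have : (0 : ℝ) < ℓ := by exact_mod_cast h0
    have := Real.pi_pos
    positivity
  rw [sinPi]
  exact_mod_cast (Real.sin_pos_of_pos_of_lt_pi h2 h1).ne'

/-- Here 24·4 ≡ 1 mod 5, so the case p ∣ A would need y² ≡ 0 and is vacuous. The same happens modulo
7 for the residue 5. -/
theorem identityCheck_five_single : ∀ ℓ ∈ Ico 1 5,
    identityCheck 5 4 (fun ℓ A => classTerms 5 ℓ 4 A) [([(1, 0)], ℓ)] = true := by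
  decide +kernel

theorem identityCheck_seven_single : ∀ ℓ ∈ Ico 1 7,
    identityCheck 7 5 (fun ℓ A => classTermsSeven ℓ 5 A) [([(1, 0)], ℓ)] = true := by
  decide +kernel

theorem evalZt_one (p : ℕ) : evalZt p [(1, 0)] = 1 := by simp [evalZt, zt_zero]

theorem five_mul_add_modEq (n : ℤ) (r : ℕ) : 5 * n + r ≡ r [ZMOD (5 : ℕ)] :=
  Int.modEq_iff_dvd.2 ⟨-n, by push_cast; ring⟩

theorem seven_mul_add_modEq (n : ℤ) (r : ℕ) : 7 * n + r ≡ r [ZMOD (7 : ℕ)] :=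
  Int.modEq_iff_dvd.2 ⟨-n, by push_cast; ring⟩

theorem S7_eq_zero (n : ℤ) {ℓ c : ℕ} (h1 : 1 ≤ ℓ) (h6 : ℓ ≤ 6) (hc : 0 < c) (h7 : 7 ∣ c) :
    e (-(1 / 8)) * SInfInf 7 ℓ (7 * n + 5) c +
      (if c / 7 * ℓ % 7 = 1 ∨ c / 7 * ℓ % 7 = 6 then
        2 * (Real.sqrt 7 : ℂ) * SZeroInf ℓ (7 * n + 5) (c / 7)
      else 0) = 0 := by
  have h := sum_S7_eq_zero (identityCheck_seven_single ℓ (by simp; omega))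
    (seven_mul_add_modEq n 5) hc h7
  simp only [List.map_cons, List.map_nil, List.sum_cons, List.sum_nil, evalZt_one, one_mul,
    add_zero, S7] at h
  exact (mul_eq_zero.1 h).resolve_left (sinPi_ne_zero (by omega) (by omega))

/-- Three-term relations between the sums `S7`. -/
theorem three_term_S7 {r : ℕ} (i₁ j₁ i₂ j₂ i₃ j₃ : ℕ)
    (h : identityCheck 7 r (fun ℓ A => classTermsSeven ℓ r A)
      [(cosTerms i₁ j₁, 1), (cosTerms i₂ j₂, 2), (cosTerms i₃ j₃, 3)] = true) (n : ℤ) {c : ℕ}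
    (hc : 0 < c) (h7 : 7 ∣ c) :
    cosDiff 7 (2 * i₁) (2 * j₁) * S7 1 (7 * n + r) c +
      cosDiff 7 (2 * i₂) (2 * j₂) * S7 2 (7 * n + r) c +
      cosDiff 7 (2 * i₃) (2 * j₃) * S7 3 (7 * n + r) c = 0 := by
  have h := sum_S7_eq_zero h (seven_mul_add_modEq n r) hc h7
  simp only [List.map_cons, List.map_nil, List.sum_cons, List.sum_nil, evalZt_cosTerms] at h
  linear_combination h / 2

theorem two_term_five {r : ℕ} (i₁ j₁ i₂ j₂ : ℕ)
    (h : identityCheck 5 r (fun ℓ A => classTerms 5 ℓ r A)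
      [(cosTerms i₁ j₁, 1), (cosTerms i₂ j₂, 2)] = true) (n : ℤ) {c : ℕ}
    (hc : 0 < c) (h5 : 5 ∣ c) :
    cosDiff 5 (2 * i₁) (2 * j₁) * sinPi 5 1 * SInfInf 5 1 (5 * n + r) c +
      cosDiff 5 (2 * i₂) (2 * j₂) * sinPi 5 2 * SInfInf 5 2 (5 * n + r) c = 0 := by
  have h := sum_SInfInf_five_eq_zero h (five_mul_add_modEq n r) hc h5
  simp only [List.map_cons, List.map_nil, List.sum_cons, List.sum_nil, evalZt_cosTerms] at h
  linear_combination h / 2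

end RankKloosterman

theorem theorem1p3 :
    -- (5-4)
    (∀ (n : ℤ) (ℓ c : ℕ), 0 ≤ n → 1 ≤ ℓ → ℓ ≤ 4 → 0 < c → 5 ∣ c →
      SInfInf 5 ℓ (5 * n + 4) c = 0) ∧
    -- (7-5,1)
    (∀ (n : ℤ) (ℓ c : ℕ), 0 ≤ n → 1 ≤ ℓ → ℓ ≤ 6 → 0 < c → 7 ∣ c →
      ¬ (((c / 7 * ℓ : ℕ) : ℤ) ≡ 1 [ZMOD 7]) → ¬ (((c / 7 * ℓ : ℕ) : ℤ) ≡ -1 [ZMOD 7]) →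
      SInfInf 7 ℓ (7 * n + 5) c = 0) ∧
    -- (7-5,2)
    (∀ (n : ℤ) (ℓ c a : ℕ), 0 ≤ n → 1 ≤ ℓ → ℓ ≤ 6 → 0 < c → c = 7 * a → ¬ 7 ∣ a →
      (((a * ℓ : ℕ) : ℤ) ≡ 1 [ZMOD 7] ∨ ((a * ℓ : ℕ) : ℤ) ≡ -1 [ZMOD 7]) →
      e (-(1 / 8)) * SInfInf 7 ℓ (7 * n + 5) c
        + 2 * (Real.sqrt 7 : ℂ) * SZeroInf ℓ (7 * n + 5) a = 0) ∧
    (∀ (n : ℤ) (c : ℕ), 0 ≤ n → 0 < c → 5 ∣ c →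
      -- (5-1)
      cosDiff 5 2 4 * sinPi 5 1 * SInfInf 5 1 (5 * n + 1) c
        + cosDiff 5 4 2 * sinPi 5 2 * SInfInf 5 2 (5 * n + 1) c = 0 ∧
      -- (5-2)
      cosDiff 5 0 4 * sinPi 5 1 * SInfInf 5 1 (5 * n + 2) c
        + cosDiff 5 0 2 * sinPi 5 2 * SInfInf 5 2 (5 * n + 2) c = 0) ∧
    (∀ (n : ℤ) (c : ℕ), 0 ≤ n → 0 < c → 7 ∣ c →
      -- (7-0)
      cosDiff 7 4 6 * S7 1 (7 * n) c + cosDiff 7 6 2 * S7 2 (7 * n) c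
        + cosDiff 7 2 4 * S7 3 (7 * n) c = 0 ∧
      -- (7-1,1)
      cosDiff 7 2 4 * S7 1 (7 * n + 1) c + cosDiff 7 4 6 * S7 2 (7 * n + 1) c
        + cosDiff 7 6 2 * S7 3 (7 * n + 1) c = 0 ∧
      -- (7-1,2)
      cosDiff 7 4 6 * S7 1 (7 * n + 1) c + cosDiff 7 6 2 * S7 2 (7 * n + 1) c
        + cosDiff 7 2 4 * S7 3 (7 * n + 1) c = 0 ∧
      -- (7-2)
      cosDiff 7 0 6 * S7 1 (7 * n + 2) c + cosDiff 7 0 2 * S7 2 (7 * n + 2) c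
        + cosDiff 7 0 4 * S7 3 (7 * n + 2) c = 0 ∧
      -- (7-3,1)
      cosDiff 7 0 4 * S7 1 (7 * n + 3) c + cosDiff 7 0 6 * S7 2 (7 * n + 3) c
        + cosDiff 7 0 2 * S7 3 (7 * n + 3) c = 0 ∧
      -- (7-3,2)
      cosDiff 7 2 6 * S7 1 (7 * n + 3) c + cosDiff 7 4 2 * S7 2 (7 * n + 3) c
        + cosDiff 7 6 4 * S7 3 (7 * n + 3) c = 0 ∧
      -- (7-4,1)
      cosDiff 7 0 2 * S7 1 (7 * n + 4) c + cosDiff 7 0 4 * S7 2 (7 * n + 4) c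
        + cosDiff 7 0 6 * S7 3 (7 * n + 4) c = 0 ∧
      -- (7-4,2)
      cosDiff 7 2 6 * S7 1 (7 * n + 4) c + cosDiff 7 4 2 * S7 2 (7 * n + 4) c
        + cosDiff 7 6 4 * S7 3 (7 * n + 4) c = 0 ∧
      -- (7-6)
      (cosDiff 7 0 4 + cosDiff 7 2 6) * S7 1 (7 * n + 6) c
        + (cosDiff 7 0 6 + cosDiff 7 4 2) * S7 2 (7 * n + 6) c
        + (cosDiff 7 0 2 + cosDiff 7 6 4) * S7 3 (7 * n + 6) c = 0) := by
  refine ⟨fun n ℓ c _ h1 h4 hc h5 => ?_, fun n ℓ c _ h1 h6 hc h7 hne hne' => ?_,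
    fun n ℓ c a _ h1 h6 hc hca _ hor => ?_, fun n c _ hc h5 => ⟨?_, ?_⟩,
    fun n c _ hc h7 => ⟨?_, ?_, ?_, ?_, ?_, ?_, ?_, ?_, ?_⟩⟩
  · have h := sum_SInfInf_five_eq_zero (identityCheck_five_single ℓ (by simp; omega))
      (five_mul_add_modEq n 4) hc h5
    simp only [List.map_cons, List.map_nil, List.sum_cons, List.sum_nil, evalZt_one, one_mul,
      add_zero] at h
    exact (mul_eq_zero.1 h).resolve_left (sinPi_ne_zero (by omega) (by omega))
  · have h := S7_eq_zero n h1 h6 hc h7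
    have h8 : ¬ (c / 7 * ℓ % 7 = 1 ∨ c / 7 * ℓ % 7 = 6) := by
      generalize c / 7 * ℓ = m at hne hne' ⊢
      simp only [Int.ModEq] at hne hne'
      omega
    rw [if_neg h8, add_zero] at h
    exact (mul_eq_zero.1 h).resolve_left (e_ne_zero _)
  · have h := S7_eq_zero n h1 h6 hc ⟨a, hca⟩
    rw [show c / 7 = a by omega, if_pos] at h
    · exact h
    · generalize a * ℓ = m at hor ⊢
      simp only [Int.ModEq] at hor
      omega
  · exact two_term_five (r := 1) 1 2 2 1 (by decide +kernel) n hc h5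
  · exact two_term_five (r := 2) 0 2 0 1 (by decide +kernel) n hc h5
  · simpa using three_term_S7 (r := 0) 2 3 3 1 1 2 (by decide +kernel) n hc h7
  · exact three_term_S7 (r := 1) 1 2 2 3 3 1 (by decide +kernel) n hc h7
  · exact three_term_S7 (r := 1) 2 3 3 1 1 2 (by decide +kernel) n hc h7
  · exact three_term_S7 (r := 2) 0 3 0 1 0 2 (by decide +kernel) n hc h7
  · exact three_term_S7 (r := 3) 0 2 0 3 0 1 (by decide +kernel) n hc h7
  · exact three_term_S7 (r := 3) 1 3 2 1 3 2 (by decide +kernel) n hc h7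
  · exact three_term_S7 (r := 4) 0 1 0 2 0 3 (by decide +kernel) n hc h7
  · exact three_term_S7 (r := 4) 1 3 2 1 3 2 (by decide +kernel) n hc h7
  · have h := sum_S7_eq_zero (r := 6)
      (cs := [(cosTerms (0 : ℕ) (2 : ℕ) ++ cosTerms (1 : ℕ) (3 : ℕ), 1),
        (cosTerms (0 : ℕ) (3 : ℕ) ++ cosTerms (2 : ℕ) (1 : ℕ), 2),
        (cosTerms (0 : ℕ) (1 : ℕ) ++ cosTerms (3 : ℕ) (2 : ℕ), 3)]) (by decide +kernel)
      (seven_mul_add_modEq n 6) hc h7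
    simp only [List.map_cons, List.map_nil, List.sum_cons, List.sum_nil, evalZt_append,
      evalZt_cosTerms] at h
    norm_num at h
    linear_combination h / 2
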